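/- **Setting.** Let $r\ge 0$ be an integer, let $\hbar,\eta$ be non-zero real numbers with $\hbar+1/\eta\ne0$, put $\eta'=1/(\hbar+1/\eta)$ and $\mathrm{sh}=\sinh$, let $B=\frac12A$ with $A$ the Cartan matrix of $sl_{r+1}$, and let $z\in\mathbb C$. The generating currents are $H^\pm_j(u),E_j(u),F_j(u)$, $1\le j\le r$. All currents are generalized functions of $u$: they are smeared, $X[\varphi]=\int\varphi(u)X(u)\,du$, with entire functions $\varphi$ which decay faster than every exponential in each horizontal strip. **Fock representation $\mathcal F(\eta)$ of level $1$.** Let $[a_i(\lambda),a_j(\mu)]=\alpha_{ij}(\lambda)\delta(\lambda+\mu)$ with $\alpha_{ij}(\lambda)=\frac4\lambda\,\mathrm{sh}\frac{\hbar\lambda}2\,\mathrm{sh}(\hbar B_{ij}\lambda)\,\mathrm{sh}\frac\lambda{2\eta}\big/\mathrm{sh}\frac\lambda{2\eta'}$, $a_j'(\lambda)=a_j(\lambda)\,\mathrm{sh}\frac\lambda{2\eta'}\big/\mathrm{sh}\frac\lambda{2\eta}$, $[P_i,Q_j]=B_{ij}$, $\phi_j(u)=\int e^{i\lambda u}\frac{a_j(\lambda)}{\mathrm{sh}(\hbar\lambda/2)}d\lambda$,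 $\phi_j'(u)=\int e^{i\lambda u}\frac{a'_j(\lambda)}{\mathrm{sh}(\hbar\lambda/2)}d\lambda$, and, with Euler's constant $\gamma$, $$E_j=e^{\gamma}e^{2\pi iQ_j}e^{P_j}:\!e^{\phi_j'(u)/2}\!:,\quad F_j=e^{\gamma}e^{-2\pi iQ_j}e^{-P_j}:\!e^{-\phi_j(u)/2}\!:,\quad H^\pm_j=\,:\!\exp\Big(\mp\int e^{i\lambda u}\frac{e^{\mp\hbar\lambda/4}}{1-e^{\pm\lambda/\eta}}a_j(\lambda)d\lambda\Big)\!:.$$ Vacuum expectation values of products of these currents and of the fields $\phi_j$ are given by Wick's theorem, with $P_i|vac\rangle=0$, $\langle vac|Q_i=0$, the contraction of $\int g_1a_i$ with $\int g_2a_j$ being $\int_C\frac{d\lambda\ln(-\lambda)}{2\pi i}\alpha_{ij}(\lambda)g_1(\lambda)g_2(-\lambda)$, where $C$ comes from $+\infty$ above the positive axis, encircles $0$ counterclockwise (and no other singularity) and returns to $+\infty$ below it; smeared products are integrated over horizontal lines whose heights decrease sufficiently fast from left to right. $\mathcal F^*$ and $\mathcal F=\mathcal F(\eta)$ are the left and right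 Fock spaces generated from $\langle vac|$ and $|vac\rangle$ by all smeared currents and fields $\phi_j$, with null vectors of the pairing divided out, and $\widehat{\mathcal F}\supseteq\mathcal F$ is the space of all linear functionals on $\mathcal F^*$. **Evaluation representation $V_z(\eta)$ of level $0$.** $V$ has basis $v_0,\dots,v_r$. Fix $\sigma\in\{1,-1\}$ and $c_E,c_F\in\mathbb C$. With $p_l=z+\frac{r-l}2i\hbar$, $1\le l\le r$, $$e_l^\pm(u)v_j=\delta_{lj}\frac{-c_E\,\mathrm{sh}(i\pi\eta\hbar)}{\mathrm{sh}\,\pi\eta(u-p_l)}v_{j-1},\qquad f_l^\pm(u)v_{j-1}=\delta_{lj}\frac{-c_F\,\mathrm{sh}(i\pi\eta\hbar)}{\mathrm{sh}\,\pi\eta(u-p_l)}v_j,$$ $H_l^\pm(u)$ multiplies $v_l$ by $\frac{\mathrm{sh}\,\pi\eta(u-p_l+i\hbar)}{\mathrm{sh}\,\pi\eta(u-p_l)}$, $v_{l-1}$ by $\frac{\mathrm{sh}\,\pi\eta(u-p_l-i\hbar)}{\mathrm{sh}\,\pi\eta(u-p_l)}$, and fixes the other $v_j$; all other actions of the half currents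 are zero. The $+$ and $-$ half currents are considered in the two strips of height $1/|\eta|$ adjacent to the line $\mathrm{Im}\,u=\mathrm{Im}\,p_l$, the $+$ strip being the lower one if $\sigma=1$ and the upper one if $\sigma=-1$. The total currents are $E_l=e_l^+-e_l^-$, $F_l=f_l^+-f_l^-$. **Comultiplication** (levels $c_1,c_2$ of the two factors): $$\Delta H_j^\pm(u)=H^\pm_j(u\pm\tfrac{i\hbar c_2}4)\otimes H^\pm_j(u\mp\tfrac{i\hbar c_1}4),\qquad\Delta E_j(u)=E_j(u)\otimes1+H_j^-(u+\tfrac{i\hbar c_1}4)\otimes E_j(u+\tfrac{i\hbar c_1}2),$$ $$\Delta F_j(u)=1\otimes F_j(u)+F_j(u+\tfrac{i\hbar c_2}2)\otimes H_j^+(u+\tfrac{i\hbar c_2}4).$$ **Vertex operators.** These are linear maps $$\Phi(z):\mathcal F\to\widehat{\mathcal F}\otimes V_{z+i\hbar/2}(\eta'),\quad\Phi^*(z):\mathcal F\otimes V_{z+i\hbar/2}(\eta')\to\widehat{\mathcal F},\quad\Psi^*(z):V_{z+i\hbar/2}(\eta)\otimes\mathcal F\to\widehat{\mathcal F},\quad\Psi(z):\mathcal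 F\to V_{z+i\hbar/2}(\eta)\otimes\widehat{\mathcal F}$$ such that $\Phi x=\Delta(x)\Phi$, $\Phi^*\Delta(x)=x\Phi^*$, $\Psi^*\Delta(x)=x\Psi^*$, $\Psi x=\Delta(x)\Psi$ for all generating currents $x$. Components: $\Phi w=\sum_j\Phi_jw\otimes v_j$, $\Phi^*(w\otimes v_j)=\Phi^*_jw$, $\Psi^*(v_j\otimes w)=\Psi_j^*w$, $\Psi w=\sum_jv_j\otimes\Psi_jw$. Here and below, identities are identities of matrix coefficients $\langle\xi|\cdot|w\rangle$ ($\xi\in\mathcal F^*$, $w\in\mathcal F$) as functionals of the test function. The product of a matrix coefficient $J$ with a meromorphic function $k$ in a strip is defined if, in some strip inside it, $J$ is represented by an analytic function $M(u)$ of at most exponential growth; it is then $\varphi\mapsto\int\varphi kM\,du$ along any horizontal line there. A product with a total current of $V$ or with $\delta(u-p)$ is defined if $J$ is so represented on both sides of the line through the pole (resp. around the line through $p$); $\delta(u-p)J$ is $\varphi\mapsto\varphi(p)M(p)$. It is part of the definition of a vertex operator that the products occurring in $\Delta(x)$ are defined. **Claim.** For every choice of $\sigma,c_E,c_F$, every vertex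 operator of each type satisfies the relations below, all products in them being defined. Put $$\rho^{\pm}_{j,s}(u;\eta)=\frac{\mathrm{sh}\,\pi\eta(u-z-\frac{r-j\mp2}2i\hbar-s\,i\hbar)}{\mathrm{sh}\,\pi\eta(u-z-\frac{r-j}2i\hbar-s\,i\hbar)},\qquad a_j=z+\tfrac{r-j}2i\hbar,\qquad\kappa_X(\eta)=-2\pi i\,\sigma\,c_X\,\frac{\mathrm{sh}(i\pi\eta\hbar)}{\pi\eta}\quad(X=E,F).$$ The factors $\rho$ in relations with $H^+_j$, and in those of $F_j$ with $\Phi,\Phi^*$, are taken in the $+$ strip adjacent to their pole $a_j+s\,i\hbar$ (height $1/|\eta'|$, resp. $1/|\eta|$); those with $H_j^-$, and those of $E_j$ with $\Psi,\Psi^*$, in the $-$ strip. In the following $1\le j\le r$, and $m\in\{0,\dots,r\}$. * $\Phi$: with $s=\frac34$ for $H^+$ and $s=\frac14$ for $H^-$: $\Phi_jH_j^\pm(u)=\rho^+_{j,s}(u;\eta')H^\pm_j(u)\Phi_j$, $\Phi_{j-1}H_j^\pm(u)=\rho^-_{j,s}(u;\eta')H^\pm_j(u)\Phi_{j-1}$,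 $\Phi_mH_j^\pm(u)=H^\pm_j(u)\Phi_m$ for $m\ne j,j-1$; $[\Phi_m,E_j(u)]=\delta_{m,j-1}\,\kappa_E(\eta')\,\delta(u-a_j)\,H_j^-(u+\frac{i\hbar}4)\Phi_j$; $\Phi_jF_j(u)=\rho^+_{j,1/2}(u;\eta')F_j(u)\Phi_j+\kappa_F(\eta')\,\delta(u-a_j-\frac{i\hbar}2)\Phi_{j-1}$, $\Phi_{j-1}F_j(u)=\rho^-_{j,1/2}(u;\eta')F_j(u)\Phi_{j-1}$, $\Phi_mF_j(u)=F_j(u)\Phi_m$ for $m\ne j,j-1$. * $\Phi^*$: with $s=\frac34$ for $H^+$ and $s=\frac14$ for $H^-$: $H_j^\pm(u)\Phi^*_j=\rho^+_{j,s}(u;\eta')\Phi^*_jH^\pm_j(u)$, $H_j^\pm(u)\Phi^*_{j-1}=\rho^-_{j,s}(u;\eta')\Phi^*_{j-1}H^\pm_j(u)$, $H_j^\pm(u)\Phi^*_m=\Phi^*_mH^\pm_j(u)$ for $m\ne j,j-1$; $[E_j(u),\Phi^*_m]=\delta_{mj}\,\kappa_E(\eta')\,\delta(u-a_j)\,\Phi^*_{j-1}H_j^-(u+\frac{i\hbar}4)$;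 $F_j(u)\Phi_j^*=\rho^+_{j,1/2}(u;\eta')\Phi_j^*F_j(u)$, $F_j(u)\Phi^*_{j-1}=\rho^-_{j,1/2}(u;\eta')\Phi^*_{j-1}F_j(u)+\kappa_F(\eta')\,\delta(u-a_j-\frac{i\hbar}2)\Phi_j^*$, $F_j(u)\Phi_m^*=\Phi_m^*F_j(u)$ for $m\ne j,j-1$. * $\Psi^*$: with $s=\frac14$ for $H^+$ and $s=\frac34$ for $H^-$: $H_j^\pm(u)\Psi^*_j=\rho^+_{j,s}(u;\eta)\Psi^*_jH^\pm_j(u)$, $H_j^\pm(u)\Psi^*_{j-1}=\rho^-_{j,s}(u;\eta)\Psi^*_{j-1}H^\pm_j(u)$, $H_j^\pm(u)\Psi^*_m=\Psi^*_mH^\pm_j(u)$ for $m\ne j,j-1$; $E_j(u)\Psi_j^*=\rho^+_{j,1/2}(u;\eta)\Psi_j^*E_j(u)+\kappa_E(\eta)\,\delta(u-a_j-\frac{i\hbar}2)\Psi_{j-1}^*$, $E_j(u)\Psi^*_{j-1}=\rho^-_{j,1/2}(u;\eta)\Psi^*_{j-1}E_j(u)$, $E_j(u)\Psi_m^*=\Psi_m^*E_j(u)$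 for $m\ne j,j-1$; $[F_j(u),\Psi^*_m]=\delta_{m,j-1}\,\kappa_F(\eta)\,\delta(u-a_j)\,\Psi^*_jH_j^+(u+\frac{i\hbar}4)$. * $\Psi$: with $s=\frac14$ for $H^+$ and $s=\frac34$ for $H^-$: $\Psi_jH_j^\pm(u)=\rho^+_{j,s}(u;\eta)H^\pm_j(u)\Psi_j$, $\Psi_{j-1}H_j^\pm(u)=\rho^-_{j,s}(u;\eta)H^\pm_j(u)\Psi_{j-1}$, $\Psi_mH_j^\pm(u)=H^\pm_j(u)\Psi_m$ for $m\ne j,j-1$; $\Psi_jE_j(u)=\rho^+_{j,1/2}(u;\eta)E_j(u)\Psi_j$, $\Psi_{j-1}E_j(u)=\rho^-_{j,1/2}(u;\eta)E_j(u)\Psi_{j-1}+\kappa_E(\eta)\,\delta(u-a_j-\frac{i\hbar}2)\Psi_j$, $\Psi_mE_j(u)=E_j(u)\Psi_m$ for $m\ne j,j-1$; $[\Psi_m,F_j(u)]=\delta_{mj}\,\kappa_F(\eta)\,\delta(u-a_j)\,H_j^+(u+\frac{i\hbar}4)\Psi_{j-1}$. -/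

import Mathlib

open MeasureTheory Filter Topology
open scoped TensorProduct

noncomputable section

namespace FockVertex

/-! ### Test functions

Currents are generalized functions of the spectral parameter. They are tested against entire
functions which decay faster than any exponential on every horizontal strip, so that spectral
parameters may be shifted by complex numbers and a delta function may sit at a complex point. -/

/-- Entire functions decaying faster than every exponential along every horizontal strip. -/
structure TestFun where
  toFun : ℂ → ℂ
  entire : Differentiable ℂ toFun
  decay : ∀ K b : ℝ, ∃ C : ℝ, ∀ u : ℂ, |u.im| ≤ b →
    ‖toFun u‖ ≤ C * Real.exp (-(K * |u.re|))

instance : CoeFun TestFun (fun _ => ℂ → ℂ) := ⟨TestFun.toFun⟩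

/-- The translate `u ↦ φ (u - σ)`. If `X[φ]` stands for `∫ φ(u) X(u) du`, then
`X[φ.shift σ]` stands for `∫ φ(u) X(u + σ) du`. -/
def TestFun.shift (φ : TestFun) (σ : ℂ) : TestFun where
  toFun := fun u => φ (u - σ)
  entire := φ.entire.comp (differentiable_id.sub_const σ)
  decay := by
    intro K b
    obtain ⟨C, hC⟩ := φ.decay K (b + |σ.im|)
    refine ⟨|C| * Real.exp (|K| * |σ.re|), fun u hu => ?_⟩
    have h1 : |(u - σ).im| ≤ b + |σ.im| := by
      rw [Complex.sub_im]
      exact (abs_sub _ _).trans (add_le_add hu le_rfl)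
    have h2 : |(|u.re| - |(u - σ).re|)| ≤ |σ.re| := by
      have h := abs_abs_sub_abs_le u.re (u - σ).re
      have e : u.re - (u - σ).re = σ.re := by rw [Complex.sub_re]; ring
      rwa [e] at h
    have h3 : K * (|u.re| - |(u - σ).re|) ≤ |K| * |σ.re| := by
      calc K * (|u.re| - |(u - σ).re|) ≤ |K * (|u.re| - |(u - σ).re|)| := le_abs_self _
        _ = |K| * |(|u.re| - |(u - σ).re|)| := abs_mul _ _
        _ ≤ |K| * |σ.re| := mul_le_mul_of_nonneg_left h2 (abs_nonneg _)
    calc ‖φ (u - σ)‖ ≤ C * Real.exp (-(K * |(u - σ).re|)) := hC _ h1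
      _ ≤ |C| * Real.exp (-(K * |(u - σ).re|)) :=
          mul_le_mul_of_nonneg_right (le_abs_self C) (Real.exp_pos _).le
      _ ≤ |C| * (Real.exp (|K| * |σ.re|) * Real.exp (-(K * |u.re|))) := by
          refine mul_le_mul_of_nonneg_left ?_ (abs_nonneg _)
          rw [← Real.exp_add]
          exact Real.exp_le_exp.mpr (by nlinarith [h3])
      _ = |C| * Real.exp (|K| * |σ.re|) * Real.exp (-(K * |u.re|)) := by ring

/-- The integral of `g` over the horizontal line `Im u = s`, from left to right. -/
def lineInt (s : ℝ) (g : ℂ → ℂ) : ℂ := ∫ x : ℝ, g (x + s * Complex.I)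

/-! ### Currents, the deformed Heisenberg algebra and the Fock representation of level one -/

/-- The generating currents; the simple root `j + 1` is labelled by `j : Fin r`. -/
inductive Current (r : ℕ) where
  | Hp (j : Fin r)
  | Hm (j : Fin r)
  | E (j : Fin r)
  | F (j : Fin r)

/-- The fields acting on the Fock space: the currents, and the boson fields
`φ_j(u) = ∫ e^{i x u} a_j(x) / sh(ħ x / 2) dx`. -/
inductive Letter (r : ℕ) where
  | cur (X : Current r)
  | boson (j : Fin r)

/-- The parameter `η'` at level one, `1/η' - 1/η = ħ`. -/
def etaPrime (ħ η : ℝ) : ℝ := 1 / (ħ + 1 / η)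

/-- `B = A / 2` for the Cartan matrix `A` of `sl_{r+1}`. -/
def halfCartan {r : ℕ} (i j : Fin r) : ℝ := (CartanMatrix.A r i j : ℝ) / 2

/-- The structure function in `[a_i(x), a_j(y)] = α_ij(x) δ(x + y)`. -/
def bosonCoeff {r : ℕ} (ħ η : ℝ) (i j : Fin r) (x : ℂ) : ℂ :=
  4 / x * Complex.sinh (ħ * x / 2) * Complex.sinh (ħ * halfCartan i j * x) *
    (Complex.sinh (x / (2 * η)) / Complex.sinh (x / (2 * etaPrime ħ η)))

def Current.root {r : ℕ} : Current r → Fin r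
  | .Hp j => j
  | .Hm j => j
  | .E j => j
  | .F j => j

def Letter.root {r : ℕ} : Letter r → Fin r
  | .cur X => X.root
  | .boson j => j

/-- The coefficient `g(x)` of `a_j(x)` in the boson field, or in the exponent of the bosonic
expression `:exp ∫ g(x) a_j(x) dx:` of a current, at the spectral parameter `u`. -/
def Letter.mode {r : ℕ} (ħ η : ℝ) (a : Letter r) (u x : ℂ) : ℂ :=
  Complex.exp (Complex.I * x * u) *
    match a with
    | .cur (.Hp _) => -(Complex.exp (-(ħ * x / 4)) / (1 - Complex.exp (x / η)))
    | .cur (.Hm _) => Complex.exp (ħ * x / 4) / (1 - Complex.exp (-(x / η)))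
    | .cur (.E _) => 1 / 2 * (Complex.sinh (x / (2 * etaPrime ħ η)) /
        Complex.sinh (x / (2 * η))) / Complex.sinh (ħ * x / 2)
    | .cur (.F _) => -(1 / 2 / Complex.sinh (ħ * x / 2))
    | .boson _ => 1 / Complex.sinh (ħ * x / 2)

/-- The current carries the zero mode factor `exp(2πi q Q_j) exp(q P_j)` with `q` its charge. -/
def Letter.charge {r : ℕ} : Letter r → ℂ
  | .cur (.E _) => 1
  | .cur (.F _) => -1
  | _ => 0

/-- The scalar prefactor `e^γ` of the currents `E` and `F`, with Euler's constant `γ`. -/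
def Letter.prefactor {r : ℕ} : Letter r → ℂ
  | .cur (.E _) => Complex.exp Real.eulerMascheroniConstant
  | .cur (.F _) => Complex.exp Real.eulerMascheroniConstant
  | _ => 1

def Letter.isBoson {r : ℕ} : Letter r → Bool
  | .boson _ => true
  | .cur _ => false

/-- The integral of `g` along the contour `C` which comes from `+∞` above the positive axis,
encircles `0` counterclockwise at distance `ε`, and returns to `+∞` below the positive axis. -/
def hankel (ε : ℝ) (g : ℂ → ℂ) : ℂ :=
  -(∫ t in Set.Ioi (-ε), g (t + ε * Complex.I))
    - Complex.I * (∫ y in (-ε)..ε, g (-ε + y * Complex.I))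
    + ∫ t in Set.Ioi (-ε), g (t - ε * Complex.I)

/-- The contraction of two fields, i.e. the exponent in the normal ordering rule:
`∫_C ln(-x)/(2πi) α(x) g₁(x) g₂(-x) dx`. The contour stays away from all singularities of the
integrand except `0`, which it encircles. -/
def contraction {r : ℕ} (ħ η : ℝ) (p q : Letter r × ℂ) : ℂ :=
  hankel (min |η| (min |etaPrime ħ η| (1 / |ħ|))) fun x =>
    Complex.log (-x) / (2 * Real.pi * Complex.I) *
      bosonCoeff ħ η p.1.root q.1.root x * p.1.mode ħ η p.2 x * q.1.mode ħ η q.2 (-x)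

/-- The factor which arises when two exponential fields are brought into normal order; the first
exponential comes from `exp(q P_i) exp(2πi q' Q_j)` and `[P_i, Q_j] = B_ij`. -/
def expFactor {r : ℕ} (ħ η : ℝ) (p q : Letter r × ℂ) : ℂ :=
  Complex.exp (2 * Real.pi * Complex.I * p.1.charge * q.1.charge *
    halfCartan p.1.root q.1.root) * Complex.exp (contraction ħ η p q)

/-- The Wick theorem: the vacuum expectation value of a product of fields at given spectral
parameters. Each boson field carries a scalar that is added to it. Moving the annihilation part
of an exponential field to the right produces the factors `expFactor` with the exponential fields
and adds the contractions to the boson fields; a leading boson field plus scalar contributes the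
scalar, plus the contractions with all fields on its right. The first argument bounds the number
of fields. -/
def wickAux {r : ℕ} (ħ η : ℝ) : ℕ → List ((Letter r × ℂ) × ℂ) → ℂ
  | 0, _ => 1
  | _ + 1, [] => 1
  | n + 1, (p, s) :: rest =>
      if p.1.isBoson then
        s * wickAux ħ η n rest +
          ∑ k : Fin rest.length, contraction ħ η p (rest.get k).1 *
            wickAux ħ η n (if (rest.get k).1.1.isBoson then rest.eraseIdx k else rest)
      else
        p.1.prefactor *
          (rest.map fun q => if q.1.1.isBoson then 1 else expFactor ħ η p q.1).prod *
          wickAux ħ η n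
            (rest.map fun q => if q.1.1.isBoson then (q.1, q.2 + contraction ħ η p q.1) else q)

def wick {r : ℕ} (ħ η : ℝ) (l : List (Letter r × ℂ)) : ℂ :=
  wickAux ħ η l.length (l.map fun p => (p, 0))

/-- Finite products of smeared fields, written from left to right. -/
abbrev Word (r : ℕ) := List (Letter r × TestFun)

/-- The vacuum expectation value of a product of smeared fields. The product of fields at points
converges if the imaginary parts of the spectral parameters decrease fast enough from left to
right, so the lines of integration are placed at distance `R` from each other, with `R` large
(the integral does not depend on `R` once `R` is large). -/
def vev {r : ℕ} (ħ η : ℝ) (ζ : Word r) : ℂ :=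
  limUnder atTop fun R : ℝ =>
    ∫ x : Fin ζ.length → ℝ,
      (∏ k, (ζ.get k).2 (x k + ((ζ.length - k : ℝ) * R : ℝ) * Complex.I)) *
        wick ħ η (List.ofFn fun k =>
          ((ζ.get k).1, (x k + ((ζ.length - k : ℝ) * R : ℝ) * Complex.I : ℂ)))

/-- The left vector `⟨vac| X₁[φ₁] ⋯ Xₙ[φₙ]`, given through its pairing with the right vectors. -/
def leftVec {r : ℕ} (ħ η : ℝ) (ζ : Word r) : Word r → ℂ := fun ξ => vev ħ η (ζ ++ ξ)

/-- The left Fock space. -/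
def leftFock (r : ℕ) (ħ η : ℝ) : Submodule ℂ (Word r → ℂ) :=
  Submodule.span ℂ (Set.range (leftVec ħ η))

/-- The right action of smeared fields on the left Fock space. -/
def rightMul {r : ℕ} (a : Letter r × TestFun) : (Word r → ℂ) →ₗ[ℂ] (Word r → ℂ) :=
  LinearMap.funLeft ℂ ℂ (fun ξ => a :: ξ)

theorem rightMul_leftVec {r : ℕ} (ħ η : ℝ) (a : Letter r × TestFun) (ζ : Word r) :
    rightMul a (leftVec ħ η ζ) = leftVec ħ η (ζ ++ [a]) := by
  funext ξ
  simp [rightMul, leftVec, LinearMap.funLeft_apply]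

theorem rightMul_mem {r : ℕ} (ħ η : ℝ) (a : Letter r × TestFun) :
    ∀ l ∈ leftFock r ħ η, rightMul a l ∈ leftFock r ħ η := by
  intro l hl
  have h : (leftFock r ħ η).map (rightMul a) ≤ leftFock r ħ η := by
    rw [leftFock, Submodule.map_span, Submodule.span_le]
    rintro _ ⟨_, ⟨ζ, rfl⟩, rfl⟩
    rw [rightMul_leftVec]
    exact Submodule.subset_span ⟨_, rfl⟩
  exact h ⟨l, hl, rfl⟩

/-- The completed right Fock space: all linear functionals on the left Fock space. -/
abbrev FockHat (r : ℕ) (ħ η : ℝ) := Module.Dual ℂ (leftFock r ħ η)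

/-- The action of the smeared field `X[φ]` on the completed right Fock space. -/
def opHat {r : ℕ} (ħ η : ℝ) (a : Letter r × TestFun) : FockHat r ħ η →ₗ[ℂ] FockHat r ħ η :=
  ((rightMul a).restrict (rightMul_mem ħ η a)).dualMap

/-- The vacuum vector. -/
def vac (r : ℕ) (ħ η : ℝ) : FockHat r ħ η :=
  (LinearMap.proj ([] : Word r)).comp (leftFock r ħ η).subtype

/-- The vector `X₁[φ₁] ⋯ Xₙ[φₙ] |vac⟩`. -/
def state {r : ℕ} (ħ η : ℝ) (ξ : Word r) : FockHat r ħ η :=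
  ξ.foldr (fun a v => opHat ħ η a v) (vac r ħ η)

/-- The right Fock space, generated from the vacuum by the smeared fields. -/
def fock (r : ℕ) (ħ η : ℝ) : Submodule ℂ (FockHat r ħ η) :=
  Submodule.span ℂ (Set.range (state ħ η))

theorem opHat_mem {r : ℕ} (ħ η : ℝ) (a : Letter r × TestFun) :
    ∀ v ∈ fock r ħ η, opHat ħ η a v ∈ fock r ħ η := by
  intro v hv
  have h : (fock r ħ η).map (opHat ħ η a) ≤ fock r ħ η := by
    rw [fock, Submodule.map_span, Submodule.span_le]
    rintro _ ⟨_, ⟨ξ, rfl⟩, rfl⟩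
    exact Submodule.subset_span ⟨a :: ξ, rfl⟩
  exact h ⟨v, hv, rfl⟩

/-- The action of a smeared field on the right Fock space. -/
def opFock {r : ℕ} (ħ η : ℝ) (a : Letter r × TestFun) : fock r ħ η →ₗ[ℂ] fock r ħ η :=
  (opHat ħ η a).restrict (opHat_mem ħ η a)

/-! ### Analytic currents and their products with meromorphic functions -/

/-- The functional `J` on test functions is represented on the strip `c < Im u < d` by the
analytic function `M` of at most exponential growth: `J[φ] = ∫ φ(u) M(u) du` along every
horizontal line in the strip. -/
def Represents (J : TestFun → ℂ) (c d : ℝ) (M : ℂ → ℂ) : Prop :=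
  DifferentiableOn ℂ M {u | c < u.im ∧ u.im < d} ∧
  (∀ a b : ℝ, c < a → b < d → ∃ C K : ℝ, ∀ u : ℂ, a ≤ u.im → u.im ≤ b →
    ‖M u‖ ≤ C * Real.exp (K * |u.re|)) ∧
  ∀ (φ : TestFun) (s : ℝ), c < s → s < d → J φ = lineInt s fun u => φ u * M u

/-- `L(u) = k(u) J(u)` as generalized functions, the meromorphic function `k` being considered
on the strip `Im u ∈ S`: the functional `J` is represented by an analytic function `M` on a strip
inside `S`, and `L[φ] = ∫ φ(u) k(u) M(u) du` along the lines there. -/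
def EqMul (S : Set ℝ) (k : ℂ → ℂ) (J L : TestFun → ℂ) : Prop :=
  ∃ (c d : ℝ) (M : ℂ → ℂ), c < d ∧ Set.Ioo c d ⊆ S ∧ Represents J c d M ∧
    ∀ (φ : TestFun), ∀ s ∈ Set.Ioo c d, L φ = lineInt s fun u => φ u * k u * M u

/-- `L(u) = (k⁺(u) - k⁻(u)) J(u)`, where `k⁺`, `k⁻` denote the meromorphic function `k` considered
on the strips `Im u ∈ Sp` and `Im u ∈ Sm`; here `J` is analytic across the line separating them. -/
def EqMulJump (Sp Sm : Set ℝ) (k : ℂ → ℂ) (J L : TestFun → ℂ) : Prop :=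
  ∃ (c d : ℝ) (M : ℂ → ℂ), (Sp ∩ Set.Ioo c d).Nonempty ∧ (Sm ∩ Set.Ioo c d).Nonempty ∧
    Represents J c d M ∧
    ∀ (φ : TestFun), ∀ s ∈ Sp ∩ Set.Ioo c d, ∀ t ∈ Sm ∩ Set.Ioo c d,
      L φ = (lineInt s fun u => φ u * k u * M u) - lineInt t fun u => φ u * k u * M u

/-- `L(u) = κ δ(u - p) J(u)`, where `J` is analytic around the line through `p`. -/
def EqDelta (κ p : ℂ) (J L : TestFun → ℂ) : Prop :=
  ∃ (c d : ℝ) (M : ℂ → ℂ), p.im ∈ Set.Ioo c d ∧ Represents J c d M ∧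
    ∀ φ : TestFun, L φ = κ * φ p * M p

/-! ### The evaluation representation -/

/-- The open interval of length `1/|η|` of imaginary parts adjacent to the point `p`, below `p`
for `σ = 1` and above `p` for `σ = -1`. -/
def strip (η : ℝ) (σ : ℤˣ) (p : ℂ) : Set ℝ :=
  if σ = 1 then Set.Ioo (p.im - 1 / |η|) p.im else Set.Ioo p.im (p.im + 1 / |η|)

/-- The middle of `strip η σ p`. -/
def midline (η : ℝ) (σ : ℤˣ) (p : ℂ) : ℝ :=
  if σ = 1 then p.im - 1 / (2 * |η|) else p.im + 1 / (2 * |η|)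

/-- The data of an evaluation representation of level zero: `η`, the spectral parameter `z`, the
normalizations `cE`, `cF` of the half currents, and the side `σ` of their poles on which the
`+` half currents are considered (the `-` half currents are considered on the opposite side). -/
structure EvalData where
  ħ : ℝ
  η : ℝ
  z : ℂ
  cE : ℂ
  cF : ℂ
  σ : ℤˣ

/-- The representation space with its basis `v_0, …, v_r`. -/
abbrev EvalSpace (r : ℕ) := Fin (r + 1) → ℂ

variable {r : ℕ}

/-- The point `z + (r - l)/2 iħ` attached to the root `l = j + 1`. -/
def EvalData.pole (D : EvalData) (j : Fin r) : ℂ :=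
  D.z + ((r : ℂ) - ((j : ℕ) + 1)) / 2 * (Complex.I * D.ħ)

/-- The coefficient of `v_m` in `Y^±(u) v_n`, where `Y^±` is `H^±_l` for `Y = H^±_l`, the half
current `e^±_l` for `Y = E_l`, and the half current `f^±_l` for `Y = F_l`. For the root `l = j + 1`
the vector `v_l` is the one with index `j.succ` and `v_{l-1}` the one with index `j.castSucc`. -/
def EvalData.kernel (D : EvalData) (Y : Current r) (m n : Fin (r + 1)) (u : ℂ) : ℂ :=
  let sh : ℂ → ℂ := fun x => Complex.sinh (Real.pi * D.η * x)
  let hEntry : Fin r → ℂ := fun j =>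
    if m = n then
      if n = j.succ then sh (u - D.pole j + Complex.I * D.ħ) / sh (u - D.pole j)
      else if n = j.castSucc then sh (u - D.pole j - Complex.I * D.ħ) / sh (u - D.pole j)
      else 1
    else 0
  match Y with
  | .Hp j => hEntry j
  | .Hm j => hEntry j
  | .E j => if n = j.succ ∧ m = j.castSucc then
      -(D.cE * sh (Complex.I * D.ħ)) / sh (u - D.pole j) else 0
  | .F j => if n = j.castSucc ∧ m = j.succ then
      -(D.cF * sh (Complex.I * D.ħ)) / sh (u - D.pole j) else 0

/-- The positions of the matrix entries which do not vanish identically by definition. -/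
def EvalData.support (Y : Current r) (m n : Fin (r + 1)) : Prop :=
  match Y with
  | .Hp _ => m = n
  | .Hm _ => m = n
  | .E j => n = j.succ ∧ m = j.castSucc
  | .F j => n = j.castSucc ∧ m = j.succ

/-- The matrix of the smeared current `Y[φ]` in the evaluation representation. The total currents
are `E = e⁺ - e⁻` and `F = f⁺ - f⁻`. -/
def EvalData.op (D : EvalData) (Y : Current r) (φ : TestFun) :
    Matrix (Fin (r + 1)) (Fin (r + 1)) ℂ := fun m n =>
  let plus := lineInt (midline D.η D.σ (D.pole Y.root)) fun u => φ u * D.kernel Y m n u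
  let minus := lineInt (midline D.η (-D.σ) (D.pole Y.root)) fun u => φ u * D.kernel Y m n u
  match Y with
  | .Hp _ => plus
  | .Hm _ => minus
  | .E _ => plus - minus
  | .F _ => plus - minus

/-- `I(u) = J(u) (Y(u + τ))_{mn}` as generalized functions, where `(Y(u))_{mn}` is the matrix entry
of the current `Y` in the evaluation representation. -/
def EvalData.IsProduct (D : EvalData) (Y : Current r) (τ : ℂ) (m n : Fin (r + 1))
    (J I : TestFun → ℂ) : Prop :=
  let Sp := strip D.η D.σ (D.pole Y.root - τ)
  let Sm := strip D.η (-D.σ) (D.pole Y.root - τ)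
  let k : ℂ → ℂ := fun u => D.kernel Y m n (u + τ)
  (¬ EvalData.support Y m n → I = 0) ∧
  (EvalData.support Y m n →
    match Y with
    | .Hp _ => EqMul Sp k J I
    | .Hm _ => EqMul Sm k J I
    | .E _ => EqMulJump Sp Sm k J I
    | .F _ => EqMulJump Sp Sm k J I)

/-! ### Comultiplication and vertex operators -/

/-- A tensor factor: the identity, or the shifted current `X(u + σ)`. -/
inductive Factor (r : ℕ) where
  | one
  | cur (X : Current r) (σ : ℂ)

/-- The comultiplication of a generating current `X(u)`, as a sum of tensor products; the levels
of the two factors are `c₁` and `c₂`. -/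
def coproduct (ħ : ℝ) (c₁ c₂ : ℂ) : Current r → List (Factor r × Factor r)
  | .Hp j => [(.cur (.Hp j) (Complex.I * ħ * c₂ / 4), .cur (.Hp j) (-(Complex.I * ħ * c₁ / 4)))]
  | .Hm j => [(.cur (.Hm j) (-(Complex.I * ħ * c₂ / 4)), .cur (.Hm j) (Complex.I * ħ * c₁ / 4))]
  | .E j => [(.cur (.E j) 0, .one),
      (.cur (.Hm j) (Complex.I * ħ * c₁ / 4), .cur (.E j) (Complex.I * ħ * c₁ / 2))]
  | .F j => [(.one, .cur (.F j) 0),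
      (.cur (.F j) (Complex.I * ħ * c₂ / 2), .cur (.Hp j) (Complex.I * ħ * c₂ / 4))]

/-- `I` is the `(m, n)` entry, with respect to the evaluation representation, of the product of a
factor acting on the Fock space and a factor acting on the evaluation representation. The Fock
space factor enters through its matrix coefficients: `N` for the identity, and `J X` for the
current `X`. -/
def EvalData.IsTerm (D : EvalData) (A B : Factor r) (N : ℂ) (J : Current r → TestFun → ℂ)
    (m n : Fin (r + 1)) (I : TestFun → ℂ) : Prop :=
  match A, B with
  | .one, .one => I = fun φ => if m = n then N * lineInt 0 φ.toFun else 0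
  | .cur X σ, .one => I = fun φ => if m = n then J X (φ.shift σ) else 0
  | .one, .cur Y τ => I = fun φ => D.op Y (φ.shift τ) m n * N
  | .cur X σ, .cur Y τ => D.IsProduct Y τ m n (fun φ => J X (φ.shift σ)) I

/-- `L` is the sum over all terms of a comultiplication and over all `n` of the entries at the
position `e n`. -/
def EvalData.IsCoefficient (D : EvalData) (terms : List (Factor r × Factor r))
    (N : Fin (r + 1) → ℂ) (J : Fin (r + 1) → Current r → TestFun → ℂ)
    (e : Fin (r + 1) → Fin (r + 1) × Fin (r + 1)) (L : TestFun → ℂ) : Prop :=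
  ∃ I : Fin terms.length → Fin (r + 1) → TestFun → ℂ,
    (∀ t n, D.IsTerm (terms.get t).1 (terms.get t).2 (N n) (J n) (e n).1 (e n).2 (I t n)) ∧
    ∀ φ, L φ = ∑ t, ∑ n, I t n φ

/-- The matrix coefficient `⟨ξ| X[φ] C |w⟩` as a functional of `φ`. -/
def after {ħ η : ℝ} (X : Current r) (C : fock r ħ η →ₗ[ℂ] FockHat r ħ η)
    (ξ : leftFock r ħ η) (w : fock r ħ η) : TestFun → ℂ :=
  fun φ => opHat ħ η (.cur X, φ) (C w) ξ

/-- The matrix coefficient `⟨ξ| C X[φ] |w⟩` as a functional of `φ`. -/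
def before {ħ η : ℝ} (C : fock r ħ η →ₗ[ℂ] FockHat r ħ η) (X : Current r)
    (ξ : leftFock r ħ η) (w : fock r ħ η) : TestFun → ℂ :=
  fun φ => C (opFock ħ η (.cur X, φ) w) ξ

variable {ħ η : ℝ}

/-- The components of `Φ`, defined by `Φ w = ∑ Φ_j w ⊗ v_j`. -/
def compPhi (Φ : fock r ħ η →ₗ[ℂ] FockHat r ħ η ⊗[ℂ] EvalSpace r) (j : Fin (r + 1)) :
    fock r ħ η →ₗ[ℂ] FockHat r ħ η :=
  (TensorProduct.rid ℂ (FockHat r ħ η)).toLinearMap ∘ₗ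
    LinearMap.lTensor (FockHat r ħ η) (LinearMap.proj j : EvalSpace r →ₗ[ℂ] ℂ) ∘ₗ Φ

/-- The components of `Φ*`, defined by `Φ*(w ⊗ v_j) = Φ*_j w`. -/
def compPhiStar (Φ : fock r ħ η ⊗[ℂ] EvalSpace r →ₗ[ℂ] FockHat r ħ η) (j : Fin (r + 1)) :
    fock r ħ η →ₗ[ℂ] FockHat r ħ η :=
  Φ ∘ₗ (TensorProduct.mk ℂ (fock r ħ η) (EvalSpace r)).flip (Pi.single j 1)

/-- The components of `Ψ*`, defined by `Ψ*(v_j ⊗ w) = Ψ*_j w`. -/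
def compPsiStar (Ψ : EvalSpace r ⊗[ℂ] fock r ħ η →ₗ[ℂ] FockHat r ħ η) (j : Fin (r + 1)) :
    fock r ħ η →ₗ[ℂ] FockHat r ħ η :=
  Ψ ∘ₗ TensorProduct.mk ℂ (EvalSpace r) (fock r ħ η) (Pi.single j 1)

/-- The components of `Ψ`, defined by `Ψ w = ∑ v_j ⊗ Ψ_j w`. -/
def compPsi (Ψ : fock r ħ η →ₗ[ℂ] EvalSpace r ⊗[ℂ] FockHat r ħ η) (j : Fin (r + 1)) :
    fock r ħ η →ₗ[ℂ] FockHat r ħ η :=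
  (TensorProduct.lid ℂ (FockHat r ħ η)).toLinearMap ∘ₗ
    LinearMap.rTensor (FockHat r ħ η) (LinearMap.proj j : EvalSpace r →ₗ[ℂ] ℂ) ∘ₗ Ψ

/-- `Φ x = Δ(x) Φ` for all generating currents `x`, where `Δ` has levels `1` and `0`. -/
def IsPhi (D : EvalData) (Φ : fock r ħ η →ₗ[ℂ] FockHat r ħ η ⊗[ℂ] EvalSpace r) : Prop :=
  ∀ (X : Current r) (ξ : leftFock r ħ η) (w : fock r ħ η) (m : Fin (r + 1)),
    D.IsCoefficient (coproduct ħ 1 0 X) (fun n => compPhi Φ n w ξ)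
      (fun n Y => after Y (compPhi Φ n) ξ w) (fun n => (m, n)) (before (compPhi Φ m) X ξ w)

/-- `Φ* Δ(x) = x Φ*` for all generating currents `x`, where `Δ` has levels `1` and `0`. -/
def IsPhiStar (D : EvalData) (Φ : fock r ħ η ⊗[ℂ] EvalSpace r →ₗ[ℂ] FockHat r ħ η) : Prop :=
  ∀ (X : Current r) (ξ : leftFock r ħ η) (w : fock r ħ η) (m : Fin (r + 1)),
    D.IsCoefficient (coproduct ħ 1 0 X) (fun n => compPhiStar Φ n w ξ)
      (fun n Y => before (compPhiStar Φ n) Y ξ w) (fun n => (n, m))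
      (after X (compPhiStar Φ m) ξ w)

/-- `Ψ* Δ(x) = x Ψ*` for all generating currents `x`, where `Δ` has levels `0` and `1`. -/
def IsPsiStar (D : EvalData) (Ψ : EvalSpace r ⊗[ℂ] fock r ħ η →ₗ[ℂ] FockHat r ħ η) : Prop :=
  ∀ (X : Current r) (ξ : leftFock r ħ η) (w : fock r ħ η) (m : Fin (r + 1)),
    D.IsCoefficient ((coproduct ħ 0 1 X).map Prod.swap) (fun n => compPsiStar Ψ n w ξ)
      (fun n Y => before (compPsiStar Ψ n) Y ξ w) (fun n => (n, m))
      (after X (compPsiStar Ψ m) ξ w)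

/-- `Ψ x = Δ(x) Ψ` for all generating currents `x`, where `Δ` has levels `0` and `1`. -/
def IsPsi (D : EvalData) (Ψ : fock r ħ η →ₗ[ℂ] EvalSpace r ⊗[ℂ] FockHat r ħ η) : Prop :=
  ∀ (X : Current r) (ξ : leftFock r ħ η) (w : fock r ħ η) (m : Fin (r + 1)),
    D.IsCoefficient ((coproduct ħ 0 1 X).map Prod.swap) (fun n => compPsi Ψ n w ξ)
      (fun n Y => after Y (compPsi Ψ n) ξ w) (fun n => (m, n)) (before (compPsi Ψ m) X ξ w)

/-! ### Notation for the exchange relations -/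

/-- `z + (r - l)/2 iħ + s iħ` for the root `l = j + 1`. -/
def point (ħ : ℝ) (z : ℂ) (j : Fin r) (s : ℂ) : ℂ :=
  z + ((r : ℂ) - ((j : ℕ) + 1)) / 2 * (Complex.I * ħ) + s * (Complex.I * ħ)

/-- The ratio of
`sh πη(u - z - (r-l+d)/2 iħ - s iħ)` and `sh πη(u - z - (r-l)/2 iħ - s iħ)` for `l = j + 1`. -/
def shRatio (ħ η : ℝ) (z : ℂ) (j : Fin r) (d s u : ℂ) : ℂ :=
  Complex.sinh (Real.pi * η *
      (u - z - ((r : ℂ) - ((j : ℕ) + 1) + d) / 2 * (Complex.I * ħ) - s * (Complex.I * ħ))) /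
    Complex.sinh (Real.pi * η *
      (u - z - ((r : ℂ) - ((j : ℕ) + 1)) / 2 * (Complex.I * ħ) - s * (Complex.I * ħ)))

/-- The coefficient of the delta function in a total current of the evaluation representation:
`-2πi σ c sh(iπηħ) / (πη)`. -/
def deltaCoeff (ħ η : ℝ) (σ : ℤˣ) (c : ℂ) : ℂ :=
  -(2 * Real.pi * Complex.I) * ((σ : ℤ) : ℂ) * c *
    (Complex.sinh (Complex.I * Real.pi * η * ħ) / (Real.pi * η))

end FockVertex

end

/-!
Every exchange relation is a matrix entry, in the evaluation representation, of the intertwining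
property. The comultiplication of a current has at most two terms, each of one of three kinds.

* A term whose evaluation factor is `1` is the product in the other order; one whose evaluation
  factor is `H^±(u + τ)` is diagonal, so it multiplies the Fock space
  factor by the ratio of hyperbolic sines `shRatio` on the strip of that half current
  (`eqMul_kernel_diag`). For the vectors on which `H^±` acts by `1`, represented functionals are
  recovered unchanged.
* A term whose Fock space factor is the identity contributes a matrix entry of a smeared total
  current `E` or `F` (`EvalData.op_E`, `EvalData.op_F`).
* A term with evaluation factor `E` or `F` and Fock space factor `H^±` gives the commutator, with a
  single nonzero matrix entry (`EvalData.isProduct_commutator`).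

The last two kinds of terms are delta functions, because the total current is the difference of two
half currents `const / sh πη(u - p)` taken on opposite sides of the pole. The analytic content is
therefore one residue computation, `lineInt_div_sinh_sub_lineInt`: for `G` holomorphic and bounded
on closed strips around the line through `p`, subtracting `G(p) / sh πη(u - p)` leaves a holomorphic
integrand which decays, so its contour may be moved across the line. The integral of
`1 / sh πη(u - p)` itself is evaluated by moving the contour halfway to the next pole, where the
integrand is a multiple of `1 / cosh`, whose primitive is `arctan ∘ sinh`.

The four types of vertex operators are handled in two pairs, according to which tensor factor is the
Fock space (`relations_of_isCoefficient_one_zero`, `relations_of_isCoefficient_zero_one`); within a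
pair, the components enter through the rows or through the columns of the evaluation matrices.
-/

namespace FockVertex

/-! ### Integrals along horizontal lines -/

theorem continuous_horizontal (s : ℝ) : Continuous fun x : ℝ => (x + s * Complex.I : ℂ) := by
  fun_prop

theorem integrable_horizontal {f : ℂ → ℂ} {s x₀ C : ℝ}
    (hf : ContinuousOn f {u | u.im = s})
    (hC : ∀ u : ℂ, u.im = s → ‖f u‖ ≤ C * (1 + (u.re - x₀) ^ 2)⁻¹) :
    Integrable fun x : ℝ => f (x + s * Complex.I) := by
  have hcont : Continuous fun x : ℝ => f (x + s * Complex.I) :=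
    hf.comp_continuous (continuous_horizontal s) fun x => by simp
  refine ((integrable_inv_one_add_sq.comp_sub_right x₀).const_mul C).mono'
    hcont.aestronglyMeasurable (Eventually.of_forall fun x => ?_)
  simpa using hC (x + s * Complex.I) (by simp)

/-- The contour may be shifted within a closed strip on which the integrand is holomorphic and
decays quadratically: the vertical sides of long rectangles do not contribute. -/
theorem lineInt_eq_of_differentiableOn {f : ℂ → ℂ} {a b x₀ C : ℝ} (hab : a ≤ b)
    (hf : DifferentiableOn ℂ f {u | a ≤ u.im ∧ u.im ≤ b})
    (hC : ∀ u : ℂ, a ≤ u.im → u.im ≤ b → ‖f u‖ ≤ C * (1 + (u.re - x₀) ^ 2)⁻¹) :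
    lineInt a f = lineInt b f := by
  have hint : ∀ s, a ≤ s → s ≤ b → Tendsto (fun T : ℝ => ∫ x in (-T)..T, f (x + s * Complex.I))
      atTop (𝓝 (lineInt s f)) := fun s has hsb =>
    intervalIntegral_tendsto_integral
      (integrable_horizontal (hf.continuousOn.mono (by rintro u rfl; exact ⟨has, hsb⟩))
        (by rintro u rfl; exact hC u has hsb))
      tendsto_neg_atTop_atBot tendsto_id
  have hvert : ∀ g : ℝ → ℝ, Tendsto (fun T => |g T - x₀|) atTop atTop →
      Tendsto (fun T => Complex.I • ∫ y in a..b, f (g T + y * Complex.I)) atTop (𝓝 0) := by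
    intro g hg
    have hlim : Tendsto (fun T => C * (1 + (g T - x₀) ^ 2)⁻¹ * |b - a|) atTop (𝓝 0) := by
      have h2 : Tendsto (fun T => (1 + (g T - x₀) ^ 2)) atTop atTop := by
        refine tendsto_atTop_add_const_left _ _ ?_
        simpa [Function.comp_def] using (tendsto_pow_atTop (two_ne_zero)).comp hg
      simpa using (h2.inv_tendsto_atTop.const_mul C).mul_const |b - a|
    refine squeeze_zero_norm (fun T => ?_) hlim
    rw [norm_smul, Complex.norm_I, one_mul]
    refine intervalIntegral.norm_integral_le_of_norm_le_const fun y hy => ?_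
    rw [Set.uIoc_of_le hab] at hy
    simpa using hC (g T + y * Complex.I) (by simpa using hy.1.le) (by simpa using hy.2)
  have hr := hvert (fun T => T)
    (tendsto_abs_atTop_atTop.comp (tendsto_atTop_add_const_right _ (-x₀) tendsto_id))
  have hl := hvert (fun T => -T) (tendsto_abs_atBot_atTop.comp
    (tendsto_atBot_add_const_right _ (-x₀) tendsto_neg_atTop_atBot))
  have hsum := (((hint a le_rfl hab).sub (hint b hab le_rfl)).add hr).sub hl
  have hzero : ∀ T : ℝ, 0 ≤ T →
      (∫ x in (-T)..T, f (x + a * Complex.I)) - (∫ x in (-T)..T, f (x + b * Complex.I)) +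
        Complex.I • (∫ y in a..b, f (T + y * Complex.I)) -
        Complex.I • (∫ y in a..b, f ((-T : ℝ) + y * Complex.I)) = 0 := by
    intro T hT
    have := Complex.integral_boundary_rect_eq_zero_of_differentiableOn f
      (⟨-T, a⟩ : ℂ) (⟨T, b⟩ : ℂ) (hf.mono (by
        rintro u ⟨-, hu⟩
        simpa [Set.uIcc_of_le hab] using hu))
    simpa using this
  have := tendsto_nhds_unique (hsum.congr' (by
    filter_upwards [eventually_ge_atTop 0] with T hT using hzero T hT)) tendsto_const_nhds
  simpa [sub_eq_zero] using this

/-! ### Residues of `G(u) / sh πη(u - p)` -/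

/-- A crude form of the exponential growth of `sinh`, enough for integrability. -/
theorem sq_re_le_norm_sinh (w : ℂ) : w.re ^ 2 ≤ 4 * ‖Complex.sinh w‖ := by
  have h1 : |Real.exp w.re - Real.exp (-w.re)| ≤ 2 * ‖Complex.sinh w‖ := by
    have := abs_norm_sub_norm_le (Complex.exp w) (Complex.exp (-w))
    rw [Complex.norm_exp, Complex.norm_exp, Complex.neg_re] at this
    refine this.trans (le_of_eq ?_)
    rw [Complex.sinh, norm_div, Complex.norm_ofNat, mul_div_cancel₀ _ two_ne_zero]
  have key : ∀ x : ℝ, 0 ≤ x → x ^ 2 / 2 ≤ Real.exp x - Real.exp (-x) := fun x hx => by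
    have h2 := Real.quadratic_le_exp_of_nonneg hx
    have h3 : Real.exp (-x) ≤ 1 := Real.exp_le_one_iff.mpr (by linarith)
    linarith
  rcases le_total 0 w.re with h | h
  · linarith [key _ h, le_abs_self (Real.exp w.re - Real.exp (-w.re))]
  · have := key (-w.re) (by linarith)
    rw [neg_neg] at this
    nlinarith [neg_abs_le (Real.exp w.re - Real.exp (-w.re))]

/-- Division by `sh πη(u - p)` turns boundedness into quadratic decay. Near the line `Re u = Re p`,
where `sinh` has zeros, the bound comes from compactness. -/
theorem exists_norm_le_of_mul_sinh {f : ℂ → ℂ} {η a b C : ℝ} {p : ℂ} (hη : η ≠ 0)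
    (hf : ContinuousOn f {u | a ≤ u.im ∧ u.im ≤ b})
    (hC : ∀ u : ℂ, a ≤ u.im → u.im ≤ b →
      ‖f u * Complex.sinh (Real.pi * η * (u - p))‖ ≤ C) :
    ∃ C' : ℝ, ∀ u : ℂ, a ≤ u.im → u.im ≤ b → ‖f u‖ ≤ C' * (1 + (u.re - p.re) ^ 2)⁻¹ := by
  obtain ⟨B, hB⟩ := (isCompact_Icc.reProdIm isCompact_Icc :
    IsCompact (Set.Icc (p.re - 1) (p.re + 1) ×ℂ Set.Icc a b)).exists_bound_of_continuousOn
      (hf.mono fun u hu => hu.2)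
  have hκ : 0 < (Real.pi * η) ^ 2 := by positivity
  refine ⟨max (2 * B) (8 * C / (Real.pi * η) ^ 2), fun u ha hb => ?_⟩
  rw [← div_eq_mul_inv, le_div_iff₀ (by positivity)]
  rcases le_total |u.re - p.re| 1 with h | h
  · have hle := abs_le.mp h
    have h1 := hB u ⟨⟨by linarith, by linarith⟩, ⟨ha, hb⟩⟩
    have h2 : (u.re - p.re) ^ 2 ≤ 1 := by rwa [sq_le_one_iff_abs_le_one]
    refine le_trans ?_ (le_max_left _ _)
    nlinarith [norm_nonneg (f u)]
  · have h2 : 1 ≤ (u.re - p.re) ^ 2 := by rwa [one_le_sq_iff_one_le_abs]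
    refine le_trans ?_ (le_max_right _ _)
    have h3 := sq_re_le_norm_sinh (Real.pi * η * (u - p))
    have h4 : ((Real.pi * η * (u - p) : ℂ)).re = Real.pi * η * (u.re - p.re) := by
      rw [← Complex.ofReal_mul, Complex.re_ofReal_mul, Complex.sub_re]
    rw [h4, mul_pow] at h3
    have h5 := hC u ha hb
    rw [norm_mul] at h5
    rw [le_div_iff₀ hκ]
    have h6 := mul_le_mul_of_nonneg_left h3 (norm_nonneg (f u))
    have h7 : 0 ≤ ‖f u‖ * (Real.pi * η) ^ 2 * ((u.re - p.re) ^ 2 - 1) := by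
      have : 0 ≤ (u.re - p.re) ^ 2 - 1 := by linarith
      positivity
    nlinarith

theorem sinh_ne_zero_of_im_ne {η : ℝ} (hη : η ≠ 0) {v : ℂ} (hv : v ≠ 0) (h : |v.im| < 1 / |η|) :
    Complex.sinh (Real.pi * η * v) ≠ 0 := by
  intro h0
  have h1 : Complex.sin (Real.pi * η * v * Complex.I) = 0 := by
    rw [Complex.sin_mul_I, h0, zero_mul]
  obtain ⟨k, hk⟩ := Complex.sin_eq_zero_iff.mp h1
  have hpi : (Real.pi : ℂ) ≠ 0 := by exact_mod_cast Real.pi_ne_zero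
  have h2 : (η : ℂ) * v * Complex.I = k := by
    apply mul_left_cancel₀ hpi
    rw [mul_comm (Real.pi : ℂ) k, ← hk]; ring
  have him : η * v.re = 0 := by
    have := congrArg Complex.im h2
    simpa using this
  have hre : -(η * v.im) = k := by
    have := congrArg Complex.re h2
    simpa using this
  have hre0 : v.re = 0 := (mul_eq_zero.mp him).resolve_left hη
  have hlt : |(k : ℝ)| < 1 := by
    rw [← hre, abs_neg, abs_mul]
    rw [lt_div_iff₀ (abs_pos.mpr hη)] at h
    linarith
  have hk0 : k = 0 := Int.abs_lt_one_iff.mp (by exact_mod_cast hlt)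
  rw [hk0, Int.cast_zero, neg_eq_zero] at hre
  exact hv (Complex.ext hre0 ((mul_eq_zero.mp hre).resolve_left hη))

theorem integral_inv_cosh : ∫ x : ℝ, (Real.cosh x)⁻¹ = Real.pi := by
  have hderiv : ∀ x : ℝ, HasDerivAt (fun x => Real.arctan (Real.sinh x)) (Real.cosh x)⁻¹ x := by
    intro x
    convert (Real.hasDerivAt_sinh x).arctan using 1
    have := Real.cosh_pos x
    rw [add_comm, ← Real.cosh_sq]
    field_simp
  have hint : Integrable fun x : ℝ => (Real.cosh x)⁻¹ := by
    refine (integrable_inv_one_add_sq.const_mul 2).mono'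
      (Real.continuous_cosh.inv₀ fun x => (Real.cosh_pos x).ne').aestronglyMeasurable
      (Eventually.of_forall fun x => ?_)
    rw [Real.norm_of_nonneg (inv_nonneg.mpr (Real.cosh_pos x).le), ← div_eq_mul_inv,
      inv_le_iff_one_le_mul₀ (Real.cosh_pos x), div_mul_eq_mul_div, le_div_iff₀ (by positivity)]
    have h1 : Real.cosh x = 1 + 2 * Real.sinh (x / 2) ^ 2 := by
      rw [show x = 2 * (x / 2) by ring, Real.cosh_two_mul, Real.cosh_sq]; ring_nf
    have h2 : (x / 2) ^ 2 ≤ Real.sinh (x / 2) ^ 2 := by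
      rw [sq_le_sq]
      rcases le_total 0 (x / 2) with h | h
      · rw [abs_of_nonneg h]
        exact (Real.self_le_sinh_iff.mpr h).trans (le_abs_self _)
      · rw [abs_of_nonpos h]
        have := Real.sinh_le_self_iff.mpr h
        exact (neg_le_neg this).trans (neg_le_abs _)
    nlinarith
  rw [integral_of_hasDerivAt_of_tendsto hderiv hint
    (m := -(Real.pi / 2)) (n := Real.pi / 2)]
  · ring
  · exact (tendsto_nhds_of_tendsto_nhdsWithin Real.tendsto_arctan_atBot).comp
      Real.sinhOrderIso.tendsto_atBot
  · exact (tendsto_nhds_of_tendsto_nhdsWithin Real.tendsto_arctan_atTop).comp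
      Real.sinhOrderIso.tendsto_atTop

theorem integral_inv_cosh_mul_sub {η : ℝ} (x₀ : ℝ) :
    ∫ x : ℝ, (Real.cosh (Real.pi * η * (x - x₀)))⁻¹ = 1 / |η| := by
  rw [integral_sub_right_eq_self (fun x => (Real.cosh (Real.pi * η * x))⁻¹) x₀,
    Measure.integral_comp_mul_left (fun x => (Real.cosh x)⁻¹) (Real.pi * η), integral_inv_cosh,
    abs_inv, abs_mul, abs_of_pos Real.pi_pos, smul_eq_mul, mul_inv, mul_right_comm,
    inv_mul_cancel₀ Real.pi_ne_zero, one_mul, one_div]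

/-- Halfway between two poles, `1 / sh πη(u - p)` is a multiple of `1 / cosh`. -/
theorem lineInt_inv_sinh_midline {η : ℝ} (hη : η ≠ 0) (σ : ℤˣ) (p : ℂ) :
    lineInt (midline η σ p) (fun u => (Complex.sinh (Real.pi * η * (u - p)))⁻¹) =
      ((σ : ℤ) : ℂ) * Complex.I / η := by
  have habs : |η| ≠ 0 := abs_ne_zero.mpr hη
  have hηC : (η : ℂ) ≠ 0 := Complex.ofReal_ne_zero.mpr hη
  have hpt : ∀ x : ℝ, (Complex.sinh (Real.pi * η * (x + midline η σ p * Complex.I - p)))⁻¹ =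
      ((σ : ℤ) : ℂ) * Complex.I * (η / |η| : ℝ) *
        ((Real.cosh (Real.pi * η * (x - p.re)))⁻¹ : ℝ) := by
    intro x
    have harg : (Real.pi * η * (x + midline η σ p * Complex.I - p) : ℂ) =
        (Real.pi * η * (x - p.re) : ℝ) - ((σ : ℤ) : ℂ) * (η / |η| : ℝ) *
          (Real.pi / 2 : ℝ) * Complex.I := by
      have habsC : ((|η| : ℝ) : ℂ) ≠ 0 := Complex.ofReal_ne_zero.mpr habs
      rcases Int.units_eq_one_or σ with rfl | rfl
      · simp [midline]
        field_simp
        linear_combination 2 * ((|η| : ℝ) : ℂ) * Complex.re_add_im p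
      · simp [midline]
        field_simp
        linear_combination 2 * ((|η| : ℝ) : ℂ) * Complex.re_add_im p
    rw [harg]
    generalize Real.pi * η * (x - p.re) = y
    have hshift : ∀ e : ℂ, e = 1 ∨ e = -1 →
        (Complex.sinh ((y : ℂ) - e * (Real.pi / 2 : ℝ) * Complex.I))⁻¹ =
        e * Complex.I * ((Real.cosh y)⁻¹ : ℝ) := by
      rintro e (rfl | rfl)
      · rw [one_mul, Complex.sinh_sub, Complex.cosh_mul_I, Complex.sinh_mul_I]
        simp [mul_comm]
      · rw [neg_one_mul, neg_mul, sub_neg_eq_add, Complex.sinh_add, Complex.cosh_mul_I,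
          Complex.sinh_mul_I]
        simp [mul_comm]
    have hsign : (η / |η| : ℝ) = 1 ∨ (η / |η| : ℝ) = -1 := by
      rcases lt_or_gt_of_ne hη with h | h
      · right; rw [abs_of_neg h]; field_simp
      · left; rw [abs_of_pos h]; field_simp
    rw [hshift, mul_right_comm]
    · ring
    · rcases Int.units_eq_one_or σ with rfl | rfl <;> rcases hsign with h | h <;> simp [h]
  unfold lineInt
  simp_rw [hpt]
  rw [integral_const_mul, integral_complex_ofReal, integral_inv_cosh_mul_sub, mul_assoc,
    ← Complex.ofReal_mul, mul_div_assoc, div_eq_mul_inv Complex.I, mul_assoc]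
  congr 2
  rw [← Complex.ofReal_inv]
  congr 1
  rw [div_mul_div_comm, abs_mul_abs_self]
  field_simp

theorem abs_im_sub_lt_of_mem_strip {η : ℝ} {σ : ℤˣ} {p : ℂ} {s : ℝ} (hs : s ∈ strip η σ p) :
    |s - p.im| < 1 / |η| ∧ s ≠ p.im := by
  unfold strip at hs
  split_ifs at hs
  · exact ⟨abs_lt.mpr ⟨by linarith [hs.1], by linarith [hs.1, hs.2]⟩, hs.2.ne⟩
  · exact ⟨abs_lt.mpr ⟨by linarith [hs.1, hs.2], by linarith [hs.2]⟩, hs.1.ne'⟩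

theorem midline_mem_strip {η : ℝ} (hη : η ≠ 0) (σ : ℤˣ) (p : ℂ) :
    midline η σ p ∈ strip η σ p := by
  have h : 0 < 1 / (2 * |η|) := by positivity
  have h2 : 1 / |η| = 2 * (1 / (2 * |η|)) := by field_simp
  unfold midline strip
  split_ifs
  · exact ⟨by linarith, by linarith⟩
  · exact ⟨by linarith, by linarith⟩

instance ordConnected_strip (η : ℝ) (σ : ℤˣ) (p : ℂ) : (strip η σ p).OrdConnected := by
  unfold strip
  split_ifs <;> exact Set.ordConnected_Ioo

/-- On a closed substrip between two poles, `1 / sh πη(u - p)` is holomorphic and decays. -/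
theorem exists_inv_sinh_decay {η : ℝ} (hη : η ≠ 0) {σ : ℤˣ} {p : ℂ} {a b : ℝ}
    (ha : a ∈ strip η σ p) (hb : b ∈ strip η σ p) :
    DifferentiableOn ℂ (fun u => (Complex.sinh (Real.pi * η * (u - p)))⁻¹)
        {u | a ≤ u.im ∧ u.im ≤ b} ∧
      ∃ C : ℝ, ∀ u : ℂ, a ≤ u.im → u.im ≤ b →
        ‖(Complex.sinh (Real.pi * η * (u - p)))⁻¹‖ ≤ C * (1 + (u.re - p.re) ^ 2)⁻¹ := by
  have hne : ∀ u : ℂ, a ≤ u.im → u.im ≤ b → Complex.sinh (Real.pi * η * (u - p)) ≠ 0 := by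
    intro u hau hub
    have h := abs_im_sub_lt_of_mem_strip ((ordConnected_strip η σ p).out ha hb ⟨hau, hub⟩)
    refine sinh_ne_zero_of_im_ne hη (sub_ne_zero.mpr ?_) (by simpa using h.1)
    rintro rfl
    exact h.2 rfl
  have hd : DifferentiableOn ℂ (fun u => (Complex.sinh (Real.pi * η * (u - p)))⁻¹)
      {u | a ≤ u.im ∧ u.im ≤ b} := by
    refine DifferentiableOn.inv (Differentiable.differentiableOn (by fun_prop)) ?_
    exact fun u hu => hne u hu.1 hu.2
  refine ⟨hd, exists_norm_le_of_mul_sinh (C := 1) hη hd.continuousOn fun u h1 h2 => ?_⟩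
  rw [inv_mul_cancel₀ (hne u h1 h2), norm_one]

theorem lineInt_inv_sinh {η : ℝ} (hη : η ≠ 0) {σ : ℤˣ} {p : ℂ} {s : ℝ} (hs : s ∈ strip η σ p) :
    lineInt s (fun u => (Complex.sinh (Real.pi * η * (u - p)))⁻¹) =
      ((σ : ℤ) : ℂ) * Complex.I / η := by
  rw [← lineInt_inv_sinh_midline hη]
  have hm := midline_mem_strip hη σ p
  rcases le_total s (midline η σ p) with h | h
  · obtain ⟨hd, C, hC⟩ := exists_inv_sinh_decay hη hs hm
    exact lineInt_eq_of_differentiableOn h hd hC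
  · obtain ⟨hd, C, hC⟩ := exists_inv_sinh_decay hη hm hs
    exact (lineInt_eq_of_differentiableOn h hd hC).symm

/-- The residue theorem for `G(u) / sh πη(u - p)` across the line through `p`. After subtraction
of `G(p) / sh πη(u - p)`, whose line integrals are known, the singularity at `p` is removable. -/
theorem lineInt_div_sinh_sub_lineInt {G : ℂ → ℂ} {η c d s t : ℝ} {p : ℂ} {σ : ℤˣ} (hη : η ≠ 0)
    (hp : p.im ∈ Set.Ioo c d)
    (hG : DifferentiableOn ℂ G {u | c < u.im ∧ u.im < d})
    (hb : ∀ a b : ℝ, c < a → b < d → ∃ C, ∀ u : ℂ, a ≤ u.im → u.im ≤ b → ‖G u‖ ≤ C)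
    (hs : s ∈ strip η σ p ∩ Set.Ioo c d) (ht : t ∈ strip η (-σ) p ∩ Set.Ioo c d) :
    lineInt s (fun u => G u * (Complex.sinh (Real.pi * η * (u - p)))⁻¹) -
        lineInt t (fun u => G u * (Complex.sinh (Real.pi * η * (u - p)))⁻¹) =
      ((σ : ℤ) : ℂ) * (2 * Complex.I / η) * G p := by
  set S : ℂ → ℂ := fun u => Complex.sinh (Real.pi * η * (u - p)) with hS
  -- `f` extends `(G(u) - G(p)) / S(u)` over `p`, where it takes the value `G'(p) / S'(p)`.
  set f : ℂ → ℂ := fun u => dslope G p u / dslope S p u with hf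
  set W : Set ℂ := {u | (c < u.im ∧ u.im < d) ∧ |u.im - p.im| < 1 / |η|} with hW
  have hSd : Differentiable ℂ S := by fun_prop
  have hSp : S p = 0 := by simp [hS]
  have hderiv : deriv S p = Real.pi * η := by
    have : HasDerivAt S (Complex.cosh (Real.pi * η * (p - p)) * (Real.pi * η * 1)) p :=
      (((hasDerivAt_id p).sub_const p).const_mul (Real.pi * η : ℂ)).csinh
    rw [this.deriv]
    simp
  have hκ : (Real.pi * η : ℂ) ≠ 0 := by
    exact_mod_cast mul_ne_zero Real.pi_ne_zero hη
  have hSne : ∀ u : ℂ, |u.im - p.im| < 1 / |η| → u ≠ p → S u ≠ 0 := fun u h hu =>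
    sinh_ne_zero_of_im_ne hη (sub_ne_zero.mpr hu) (by simpa using h)
  have hslope : ∀ u ∈ W, dslope S p u ≠ 0 := by
    intro u hu
    by_cases h : u = p
    · rw [h, dslope_same, hderiv]; exact hκ
    · rw [dslope_of_ne _ h, slope_def_field, hSp, sub_zero]
      exact div_ne_zero (hSne u hu.2 h) (sub_ne_zero.mpr h)
  have hfS : ∀ u ∈ W, f u * S u = G u - G p := by
    intro u hu
    by_cases h : u = p
    · rw [h, hSp, mul_zero, sub_self]
    · have h1 := hSne u hu.2 h
      have h2 := sub_ne_zero.mpr h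
      simp only [hf]
      rw [dslope_of_ne _ h, dslope_of_ne _ h, slope_def_field, slope_def_field, hSp, sub_zero]
      field_simp
  have hopen : IsOpen {u : ℂ | c < u.im ∧ u.im < d} :=
    (isOpen_lt continuous_const Complex.continuous_im).inter
      (isOpen_lt Complex.continuous_im continuous_const)
  have hfd : DifferentiableOn ℂ f W := by
    refine DifferentiableOn.div ?_ ?_ hslope
    · exact ((Complex.differentiableOn_dslope (hopen.mem_nhds hp)).mpr hG).mono fun u hu => hu.1
    · exact ((Complex.differentiableOn_dslope univ_mem).mpr hSd.differentiableOn).mono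
        (Set.subset_univ _)
  have hline : ∀ a b : ℝ, a ∈ Set.Ioo c d → b ∈ Set.Ioo c d → |a - p.im| < 1 / |η| →
      |b - p.im| < 1 / |η| → (∀ u : ℂ, a ≤ u.im ∧ u.im ≤ b → u ∈ W) ∧
      ∃ C : ℝ, ∀ u : ℂ, a ≤ u.im → u.im ≤ b → ‖f u‖ ≤ C * (1 + (u.re - p.re) ^ 2)⁻¹ := by
    intro a b ha hb' hap hbp
    have hsub : ∀ u : ℂ, a ≤ u.im ∧ u.im ≤ b → u ∈ W := fun u hu =>
      ⟨⟨ha.1.trans_le hu.1, hu.2.trans_lt hb'.2⟩, abs_lt.mpr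
        ⟨by linarith [(abs_lt.mp hap).1, hu.1], by linarith [(abs_lt.mp hbp).2, hu.2]⟩⟩
    obtain ⟨C, hC⟩ := hb a b ha.1 hb'.2
    refine ⟨hsub, exists_norm_le_of_mul_sinh (C := C + ‖G p‖) hη
      (hfd.continuousOn.mono hsub) fun u h1 h2 => ?_⟩
    rw [show Complex.sinh (Real.pi * η * (u - p)) = S u from rfl, hfS u (hsub u ⟨h1, h2⟩)]
    exact (norm_sub_le _ _).trans (add_le_add (hC u h1 h2) le_rfl)
  have hcontour : lineInt s f = lineInt t f := by
    have h1 := (abs_im_sub_lt_of_mem_strip hs.1).1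
    have h2 := (abs_im_sub_lt_of_mem_strip ht.1).1
    rcases le_total s t with h | h
    · obtain ⟨hsub, C, hC⟩ := hline s t hs.2 ht.2 h1 h2
      exact lineInt_eq_of_differentiableOn h (hfd.mono hsub) hC
    · obtain ⟨hsub, C, hC⟩ := hline t s ht.2 hs.2 h2 h1
      exact (lineInt_eq_of_differentiableOn h (hfd.mono hsub) hC).symm
  have hsplit : ∀ (τ : ℤˣ) (a : ℝ), a ∈ strip η τ p ∩ Set.Ioo c d →
      lineInt a (fun u => G u * (S u)⁻¹) = lineInt a f + G p * (((τ : ℤ) : ℂ) * Complex.I / η) := by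
    intro τ a ha
    have h1 := abs_im_sub_lt_of_mem_strip ha.1
    obtain ⟨hsub, C, hC⟩ := hline a a ha.2 ha.2 h1.1 h1.1
    obtain ⟨hd, C', hC'⟩ := exists_inv_sinh_decay hη ha.1 ha.1
    rw [← lineInt_inv_sinh hη ha.1]
    unfold lineInt
    rw [← integral_const_mul, ← integral_add]
    · refine integral_congr_ae (Eventually.of_forall fun x => ?_)
      have him : ((x : ℂ) + a * Complex.I).im = a := by simp
      have hne : S (x + a * Complex.I) ≠ 0 := by
        refine hSne _ (by rw [him]; exact h1.1) fun h => h1.2 ?_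
        rw [← h, him]
      have := hfS (x + a * Complex.I) (hsub _ ⟨him.ge, him.le⟩)
      simp only
      rw [show Complex.sinh (Real.pi * η * (x + a * Complex.I - p)) =
        S (x + a * Complex.I) from rfl]
      field_simp
      linear_combination -this
    · exact integrable_horizontal (hfd.continuousOn.mono (by
        rintro u rfl; exact hsub u ⟨le_rfl, le_rfl⟩)) (by rintro u rfl; exact hC u le_rfl le_rfl)
    · exact (integrable_horizontal (f := fun u => (Complex.sinh (Real.pi * η * (u - p)))⁻¹)
        (hd.continuousOn.mono (by rintro u rfl; exact ⟨le_rfl, le_rfl⟩))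
        (by rintro u rfl; exact hC' u le_rfl le_rfl)).const_mul _
  rw [hsplit σ s hs, hsplit (-σ) t ht, hcontour]
  push_cast
  ring

/-! ### Delta functions from the total currents -/

theorem TestFun.exists_norm_mul_le (φ : TestFun) {M : ℂ → ℂ} {a b C K : ℝ}
    (hM : ∀ u : ℂ, a ≤ u.im → u.im ≤ b → ‖M u‖ ≤ C * Real.exp (K * |u.re|)) :
    ∃ C', ∀ u : ℂ, a ≤ u.im → u.im ≤ b → ‖φ u * M u‖ ≤ C' := by
  -- The test function decays at the rate at which `M` may grow.
  obtain ⟨B, hB⟩ := φ.decay K (max |a| |b|)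
  refine ⟨B * C, fun u ha hb => ?_⟩
  have h1 := hB u (abs_le_max_abs_abs ha hb)
  have h2 := hM u ha hb
  calc ‖φ u * M u‖ = ‖φ u‖ * ‖M u‖ := norm_mul _ _
    _ ≤ (B * Real.exp (-(K * |u.re|))) * (C * Real.exp (K * |u.re|)) :=
        mul_le_mul h1 h2 (norm_nonneg _) ((norm_nonneg _).trans h1)
    _ = B * C * (Real.exp (-(K * |u.re|)) * Real.exp (K * |u.re|)) := by ring
    _ = B * C := by rw [← Real.exp_add, neg_add_cancel, Real.exp_zero, mul_one]

@[simp]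
theorem TestFun.shift_zero (φ : TestFun) : φ.shift 0 = φ := by
  cases φ
  simp [TestFun.shift]

/-- The two half currents of the evaluation representation differ by a delta function: the
difference of the two line integrals is the residue at the pole. -/
theorem lineInt_halfCurrent_sub_lineInt {ħ η a b s t : ℝ} {x p : ℂ} {σ : ℤˣ} {M : ℂ → ℂ}
    (hη : η ≠ 0) (φ : TestFun) (hp : p.im ∈ Set.Ioo a b)
    (hM : DifferentiableOn ℂ M {u | a < u.im ∧ u.im < b})
    (hgrowth : ∀ a' b' : ℝ, a < a' → b' < b → ∃ C K : ℝ, ∀ u : ℂ, a' ≤ u.im → u.im ≤ b' →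
      ‖M u‖ ≤ C * Real.exp (K * |u.re|))
    (hs : s ∈ strip η σ p ∩ Set.Ioo a b) (ht : t ∈ strip η (-σ) p ∩ Set.Ioo a b) :
    (lineInt s fun u => φ u * (-(x * Complex.sinh (Real.pi * η * (Complex.I * ħ))) /
          Complex.sinh (Real.pi * η * (u - p))) * M u) -
        (lineInt t fun u => φ u * (-(x * Complex.sinh (Real.pi * η * (Complex.I * ħ))) /
          Complex.sinh (Real.pi * η * (u - p))) * M u) =
      deltaCoeff ħ η σ x * φ p * M p := by
  have hres := lineInt_div_sinh_sub_lineInt (G := fun u => φ u * M u) hη hp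
    (φ.entire.differentiableOn.mul hM) (fun a' b' ha' hb' => by
      obtain ⟨C, K, hC⟩ := hgrowth a' b' ha' hb'
      exact φ.exists_norm_mul_le hC) hs ht
  have hfactor : ∀ y : ℝ, (lineInt y fun u => φ u *
      (-(x * Complex.sinh (Real.pi * η * (Complex.I * ħ))) /
        Complex.sinh (Real.pi * η * (u - p))) * M u) =
      -(x * Complex.sinh (Real.pi * η * (Complex.I * ħ))) *
        lineInt y (fun u => φ u * M u * (Complex.sinh (Real.pi * η * (u - p)))⁻¹) := by
    intro y
    unfold lineInt
    rw [← integral_const_mul]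
    exact integral_congr_ae (Eventually.of_forall fun v => by
      simp only [div_eq_mul_inv]; ring)
  have hpi : (Real.pi : ℂ) ≠ 0 := by exact_mod_cast Real.pi_ne_zero
  have hηC : (η : ℂ) ≠ 0 := Complex.ofReal_ne_zero.mpr hη
  rw [hfactor, hfactor, ← mul_sub, hres, deltaCoeff,
    show (Complex.I * Real.pi * η * ħ : ℂ) = Real.pi * η * (Complex.I * ħ) by ring]
  field_simp

theorem eqDelta_of_eqMulJump {ħ η : ℝ} {x p : ℂ} {σ : ℤˣ} {J L : TestFun → ℂ} (hη : η ≠ 0)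
    (h : EqMulJump (strip η σ p) (strip η (-σ) p)
      (fun u => -(x * Complex.sinh (Real.pi * η * (Complex.I * ħ))) /
        Complex.sinh (Real.pi * η * (u - p))) J L) :
    EqDelta (deltaCoeff ħ η σ x) p J L := by
  obtain ⟨c, d, M, ⟨s, hs⟩, ⟨t, ht⟩, hM, hL⟩ := h
  -- The strips lie on opposite sides of the line through `p`, and both meet `c < Im u < d`.
  have hp : p.im ∈ Set.Ioo c d := by
    have hs' := hs
    have ht' := ht
    unfold strip at hs' ht'
    rcases Int.units_eq_one_or σ with rfl | rfl
    · rw [if_pos rfl] at hs'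
      rw [if_neg (by decide)] at ht'
      exact ⟨hs'.2.1.trans hs'.1.2, ht'.1.1.trans ht'.2.2⟩
    · rw [if_neg (by decide)] at hs'
      rw [neg_neg, if_pos rfl] at ht'
      exact ⟨ht'.2.1.trans ht'.1.2, hs'.1.1.trans hs'.2.2⟩
  refine ⟨c, d, M, hp, hM, fun φ => ?_⟩
  rw [hL φ s hs t ht]
  exact lineInt_halfCurrent_sub_lineInt hη φ hp hM.1 hM.2.1 hs ht

variable {r : ℕ}

/-- The smeared total current `∫ φ(u) (k⁺(u) - k⁻(u)) du` of the evaluation representation is a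
delta function. -/
theorem lineInt_midline_sub_lineInt_midline {ħ η : ℝ} (hη : η ≠ 0) (x p : ℂ) (σ : ℤˣ)
    (φ : TestFun) :
    (lineInt (midline η σ p) fun u => φ u *
        (-(x * Complex.sinh (Real.pi * η * (Complex.I * ħ))) /
          Complex.sinh (Real.pi * η * (u - p)))) -
        (lineInt (midline η (-σ) p) fun u => φ u *
        (-(x * Complex.sinh (Real.pi * η * (Complex.I * ħ))) /
          Complex.sinh (Real.pi * η * (u - p)))) =
      deltaCoeff ħ η σ x * φ p := by
  have hmid : ∀ τ : ℤˣ, midline η τ p ∈ strip η τ p ∩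
      Set.Ioo (p.im - 1 / |η|) (p.im + 1 / |η|) := fun τ => by
    have h := abs_lt.mp (abs_im_sub_lt_of_mem_strip (midline_mem_strip hη τ p)).1
    exact ⟨midline_mem_strip hη τ p, by linarith [h.1], by linarith [h.2]⟩
  have hpos : 0 < 1 / |η| := one_div_pos.mpr (abs_pos.mpr hη)
  simpa using lineInt_halfCurrent_sub_lineInt (ħ := ħ) (x := x) (M := fun _ => 1) hη φ
    ⟨by linarith, by linarith⟩ (differentiableOn_const _)
    (fun _ _ _ _ => ⟨1, 0, fun u _ _ => by simp⟩) (hmid σ) (hmid (-σ))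

theorem EvalData.op_E (D : EvalData) (hη : D.η ≠ 0) (j : Fin r) (φ : TestFun)
    (m n : Fin (r + 1)) :
    D.op (.E j) φ m n = if n = j.succ ∧ m = j.castSucc then
      deltaCoeff D.ħ D.η D.σ D.cE * φ (D.pole j) else 0 := by
  split_ifs with h
  · simpa [EvalData.op, EvalData.kernel, h, Current.root] using
      lineInt_midline_sub_lineInt_midline (ħ := D.ħ) hη D.cE (D.pole j) D.σ φ
  · simp [EvalData.op, EvalData.kernel, h, lineInt]

theorem EvalData.op_F (D : EvalData) (hη : D.η ≠ 0) (j : Fin r) (φ : TestFun)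
    (m n : Fin (r + 1)) :
    D.op (.F j) φ m n = if n = j.castSucc ∧ m = j.succ then
      deltaCoeff D.ħ D.η D.σ D.cF * φ (D.pole j) else 0 := by
  split_ifs with h
  · simpa [EvalData.op, EvalData.kernel, h, Current.root] using
      lineInt_midline_sub_lineInt_midline (ħ := D.ħ) hη D.cF (D.pole j) D.σ φ
  · simp [EvalData.op, EvalData.kernel, h, lineInt]

/-! ### Matrix entries of the intertwining relations -/

section Coefficients

variable {D : EvalData} {X Y Z : Current r} {a b τ : ℂ} {N : Fin (r + 1) → ℂ}
  {J : Fin (r + 1) → Current r → TestFun → ℂ} {e : Fin (r + 1) → Fin (r + 1) × Fin (r + 1)}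
  {L : TestFun → ℂ} {m : Fin (r + 1)}

/-- For a group-like current only the diagonal matrix entry contributes. -/
theorem EvalData.isProduct_of_isCoefficient_singleton
    (h : D.IsCoefficient [(.cur X 0, .cur Y τ)] N J e L)
    (hm : ∀ n, EvalData.support Y (e n).1 (e n).2 → n = m) :
    D.IsProduct Y τ (e m).1 (e m).2 (J m X) L := by
  obtain ⟨I, hI, hL⟩ := h
  have hLI : L = I (0 : Fin 1) m := by
    funext φ
    refine (hL φ).trans ((Fin.sum_univ_one _).trans ?_)
    exact Finset.sum_eq_single m (fun n _ hn =>
      congrFun ((hI (0 : Fin 1) n).1 fun hsupp => hn (hm n hsupp)) φ) (by simp)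
  have hprod : D.IsProduct Y τ (e m).1 (e m).2 (fun φ => J m X (φ.shift 0)) (I (0 : Fin 1) m) :=
    hI (0 : Fin 1) m
  rw [hLI]
  simpa using hprod

/-- If the Fock space factor of the first term of the comultiplication is the identity, that term
contributes matrix entries of a smeared current of the evaluation representation. -/
theorem EvalData.isProduct_of_isCoefficient_one_left
    (h : D.IsCoefficient [(.one, .cur Z 0), (.cur X 0, .cur Y τ)] N J e L)
    (hm : ∀ n, EvalData.support Y (e n).1 (e n).2 → n = m) :
    D.IsProduct Y τ (e m).1 (e m).2 (J m X)
      (fun φ => L φ - ∑ n, D.op Z φ (e n).1 (e n).2 * N n) := by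
  obtain ⟨I, hI, hL⟩ := h
  have hLI : (fun φ => L φ - ∑ n, D.op Z φ (e n).1 (e n).2 * N n) = I (1 : Fin 2) m := by
    funext φ
    have hsum : L φ = ∑ n, I (0 : Fin 2) n φ + ∑ n, I (1 : Fin 2) n φ :=
      (hL φ).trans (Fin.sum_univ_two _)
    have h0 : ∀ n, I (0 : Fin 2) n φ = D.op Z φ (e n).1 (e n).2 * N n := fun n => by
      have : I (0 : Fin 2) n = fun φ => D.op Z (φ.shift 0) (e n).1 (e n).2 * N n :=
        hI (0 : Fin 2) n
      rw [this]
      simp only [TestFun.shift_zero]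
    rw [hsum, Finset.sum_congr rfl fun n _ => h0 n, add_sub_cancel_left]
    exact Finset.sum_eq_single m (fun n _ hn =>
      congrFun ((hI (1 : Fin 2) n).1 fun hsupp => hn (hm n hsupp)) φ) (by simp)
  have hprod : D.IsProduct Y τ (e m).1 (e m).2 (fun φ => J m X (φ.shift 0)) (I (1 : Fin 2) m) :=
    hI (1 : Fin 2) m
  rw [hLI]
  simpa using hprod

end Coefficients

/-- If the evaluation factor of the first term of the comultiplication is the identity, that term
contributes the product in the other order, and the second term the commutator, which vanishes
except at the single position `(m₀, n₀)` where the current `Z` has a matrix entry. -/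
theorem EvalData.isProduct_commutator {D : EvalData} {X Y Z : Current r} {b τ : ℂ}
    {N : Fin (r + 1) → ℂ} {J : Fin (r + 1) → Current r → TestFun → ℂ}
    {e : Fin (r + 1) → Fin (r + 1) → Fin (r + 1) × Fin (r + 1)}
    {L : Fin (r + 1) → TestFun → ℂ} {m₀ n₀ : Fin (r + 1)}
    (h : ∀ m, D.IsCoefficient [(.cur X 0, .one), (.cur Y b, .cur Z τ)] N J (e m) (L m))
    (hdiag : ∀ m n, (e m n).1 = (e m n).2 ↔ n = m)
    (hZ : ∀ m n, EvalData.support Z (e m n).1 (e m n).2 ↔ m = m₀ ∧ n = n₀) :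
    D.IsProduct Z τ (e m₀ n₀).1 (e m₀ n₀).2 (fun φ => J n₀ Y (φ.shift b)) (L m₀ - J m₀ X) ∧
      ∀ l, l ≠ m₀ → L l = J l X := by
  have key : ∀ m, ∃ I : Fin (r + 1) → TestFun → ℂ,
      (∀ n, D.IsProduct Z τ (e m n).1 (e m n).2 (fun φ => J n Y (φ.shift b)) (I n)) ∧
      L m - J m X = ∑ n, I n := by
    intro m
    obtain ⟨I, hI, hL⟩ := h m
    refine ⟨I (1 : Fin 2), hI (1 : Fin 2), ?_⟩
    funext φ
    have hsum : L m φ = ∑ n, I (0 : Fin 2) n φ + ∑ n, I (1 : Fin 2) n φ :=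
      (hL φ).trans (Fin.sum_univ_two _)
    have h0 : ∀ n, I (0 : Fin 2) n φ = if n = m then J n X φ else 0 := fun n => by
      have : I (0 : Fin 2) n =
          fun φ => if (e m n).1 = (e m n).2 then J n X (φ.shift 0) else 0 := hI (0 : Fin 2) n
      rw [this]
      simp [hdiag]
    rw [Pi.sub_apply, hsum, Finset.sum_congr rfl fun n _ => h0 n]
    simp
  refine ⟨?_, fun l hl => ?_⟩
  · obtain ⟨I, hI, hL⟩ := key m₀
    rw [hL, Finset.sum_eq_single n₀ (fun n _ hn => (hI n).1 fun hs => hn ((hZ _ _).mp hs).2)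
      (by simp)]
    exact hI n₀
  · obtain ⟨I, hI, hL⟩ := key l
    rw [← sub_eq_zero, hL]
    exact Finset.sum_eq_zero fun n _ => (hI n).1 fun hs => hl ((hZ _ _).mp hs).1

/-! ### The exchange relations -/

section Relations

variable {ħ η : ℝ} {z cE cF : ℂ} {σ : ℤˣ} {s τ : ℂ}

/-- The pole of a half current `Y(u + τ)` in `u`; `z + iħ/2` is the spectral parameter of the
evaluation representation in all four types of vertex operators. -/
theorem pole_sub_eq_point (j : Fin r) (hτ : τ = (1 / 2 - s) * (Complex.I * ħ)) :
    (⟨ħ, η, z + Complex.I * ħ / 2, cE, cF, σ⟩ : EvalData).pole j - τ = point ħ z j s := by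
  simp only [EvalData.pole, point, hτ]
  ring

theorem pole_eq_point (j : Fin r) :
    (⟨ħ, η, z + Complex.I * ħ / 2, cE, cF, σ⟩ : EvalData).pole j = point ħ z j (1 / 2) := by
  simpa using pole_sub_eq_point (η := η) (cE := cE) (cF := cF) (σ := σ) (τ := 0) (z := z)
    (ħ := ħ) (s := 1 / 2) j (by ring)

theorem sinh_div_sinh_eq_shRatio (j : Fin r) (ε u : ℂ)
    (hτ : τ = (1 / 2 - s) * (Complex.I * ħ)) :
    Complex.sinh (Real.pi * η * (u + τ -
        (⟨ħ, η, z + Complex.I * ħ / 2, cE, cF, σ⟩ : EvalData).pole j + ε * (Complex.I * ħ))) /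
      Complex.sinh (Real.pi * η * (u + τ -
        (⟨ħ, η, z + Complex.I * ħ / 2, cE, cF, σ⟩ : EvalData).pole j)) =
      shRatio ħ η z j (-2 * ε) s u := by
  simp only [EvalData.pole, shRatio, hτ]
  congr 3 <;> ring

/-- The three cases of multiplication by the diagonal matrix entries of `H^±`, considered on the
strip `S`. The currents `H⁺` and `H⁻` have the same entries and differ only in the strip. -/
theorem eqMul_kernel_diag {S : Set ℝ} {k : Fin (r + 1) → ℂ → ℂ} (j : Fin r)
    (hτ : τ = (1 / 2 - s) * (Complex.I * ħ))
    (hk : ∀ m u, k m u =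
      (⟨ħ, η, z + Complex.I * ħ / 2, cE, cF, σ⟩ : EvalData).kernel (.Hp j) m m (u + τ))
    {J L : Fin (r + 1) → TestFun → ℂ} (h : ∀ m, EqMul S (k m) (J m) (L m)) :
    EqMul S (shRatio ħ η z j (-2) s) (J j.succ) (L j.succ) ∧
    EqMul S (shRatio ħ η z j 2 s) (J j.castSucc) (L j.castSucc) ∧
    ∀ l : Fin (r + 1), l ≠ j.succ → l ≠ j.castSucc → L l = J l := by
  have hne : j.castSucc ≠ j.succ := (Fin.castSucc_lt_succ).ne
  refine ⟨?_, ?_, fun l h1 h2 => ?_⟩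
  · convert h j.succ using 1
    funext u
    rw [hk]
    simpa [EvalData.kernel] using (sinh_div_sinh_eq_shRatio (η := η) (z := z) (cE := cE)
      (cF := cF) (σ := σ) j 1 u hτ).symm
  · convert h j.castSucc using 1
    funext u
    rw [hk]
    simpa [EvalData.kernel, hne, ← sub_eq_add_neg] using (sinh_div_sinh_eq_shRatio (η := η)
      (z := z) (cE := cE) (cF := cF) (σ := σ) j (-1) u hτ).symm
  · obtain ⟨c, d, M, hcd, -, hM, hL⟩ := h l
    funext φ
    obtain ⟨y, hy⟩ := exists_between hcd
    rw [hL φ y hy, hM.2.2 φ y hy.1 hy.2]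
    simp [hk, EvalData.kernel, h1, h2]

theorem eqMul_of_isProduct_Hp (j : Fin r) (hτ : τ = (1 / 2 - s) * (Complex.I * ħ))
    {J L : Fin (r + 1) → TestFun → ℂ}
    (h : ∀ m, (⟨ħ, η, z + Complex.I * ħ / 2, cE, cF, σ⟩ : EvalData).IsProduct (.Hp j) τ m m
      (J m) (L m)) :
    EqMul (strip η σ (point ħ z j s)) (shRatio ħ η z j (-2) s) (J j.succ) (L j.succ) ∧
    EqMul (strip η σ (point ħ z j s)) (shRatio ħ η z j 2 s) (J j.castSucc) (L j.castSucc) ∧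
    ∀ l : Fin (r + 1), l ≠ j.succ → l ≠ j.castSucc → L l = J l := by
  rw [← pole_sub_eq_point (η := η) (cE := cE) (cF := cF) (σ := σ) j hτ]
  exact eqMul_kernel_diag j hτ (fun _ _ => rfl) fun m => (h m).2 rfl

theorem eqMul_of_isProduct_Hm (j : Fin r) (hτ : τ = (1 / 2 - s) * (Complex.I * ħ))
    {J L : Fin (r + 1) → TestFun → ℂ}
    (h : ∀ m, (⟨ħ, η, z + Complex.I * ħ / 2, cE, cF, σ⟩ : EvalData).IsProduct (.Hm j) τ m m
      (J m) (L m)) :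
    EqMul (strip η (-σ) (point ħ z j s)) (shRatio ħ η z j (-2) s) (J j.succ) (L j.succ) ∧
    EqMul (strip η (-σ) (point ħ z j s)) (shRatio ħ η z j 2 s) (J j.castSucc) (L j.castSucc) ∧
    ∀ l : Fin (r + 1), l ≠ j.succ → l ≠ j.castSucc → L l = J l := by
  rw [← pole_sub_eq_point (η := η) (cE := cE) (cF := cF) (σ := σ) j hτ]
  exact eqMul_kernel_diag j hτ (fun _ _ => rfl) fun m => (h m).2 rfl

theorem eqDelta_of_isProduct_E (hη : η ≠ 0) (j : Fin r) {J L : TestFun → ℂ}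
    (h : (⟨ħ, η, z + Complex.I * ħ / 2, cE, cF, σ⟩ : EvalData).IsProduct (.E j)
      (Complex.I * ħ / 2) j.castSucc j.succ J L) :
    EqDelta (deltaCoeff ħ η σ cE) (point ħ z j 0) J L := by
  have hp : (⟨ħ, η, z + Complex.I * ħ / 2, cE, cF, σ⟩ : EvalData).pole j - Complex.I * ħ / 2 =
      point ħ z j 0 := pole_sub_eq_point j (by ring)
  have hj := h.2 ⟨rfl, rfl⟩
  rw [← hp]
  refine eqDelta_of_eqMulJump (ħ := ħ) hη ?_
  simp only [EvalData.kernel, and_self, if_true, Current.root] at hj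
  simp only [sub_sub_eq_add_sub]
  exact hj

theorem eqDelta_of_isProduct_F (hη : η ≠ 0) (j : Fin r) {J L : TestFun → ℂ}
    (h : (⟨ħ, η, z + Complex.I * ħ / 2, cE, cF, σ⟩ : EvalData).IsProduct (.F j)
      (Complex.I * ħ / 2) j.succ j.castSucc J L) :
    EqDelta (deltaCoeff ħ η σ cF) (point ħ z j 0) J L := by
  have hp : (⟨ħ, η, z + Complex.I * ħ / 2, cE, cF, σ⟩ : EvalData).pole j - Complex.I * ħ / 2 =
      point ħ z j 0 := pole_sub_eq_point j (by ring)
  have hj := h.2 ⟨rfl, rfl⟩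
  rw [← hp]
  refine eqDelta_of_eqMulJump (ħ := ħ) hη ?_
  simp only [EvalData.kernel, and_self, if_true, Current.root] at hj
  simp only [sub_sub_eq_add_sub]
  exact hj

variable {N : Fin (r + 1) → ℂ} {J L : Fin (r + 1) → Current r → TestFun → ℂ}
  {e : Fin (r + 1) → Fin (r + 1) → Fin (r + 1) × Fin (r + 1)} {p q : Fin r → Fin (r + 1)}

/-- The relations which follow from the comultiplication when the Fock space is the first factor.
The matrix entries `e m n` are either `(m, n)` or `(n, m)`; accordingly `E_j` has its entry at
`m = p j`, `n = q j`, and `F_j` at `m = q j`, `n = p j`. The functionals `L` and `J` are the matrix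
coefficients with the current on the two sides of a component, and `N` those of the component. -/
theorem relations_of_isCoefficient_one_zero (hη : η ≠ 0)
    (he : ∀ m, e m m = (m, m)) (hdiag : ∀ m n, (e m n).1 = (e m n).2 ↔ n = m)
    (hE : ∀ j m n, (e m n).2 = j.succ ∧ (e m n).1 = j.castSucc ↔ m = p j ∧ n = q j)
    (hF : ∀ j m n, (e m n).2 = j.castSucc ∧ (e m n).1 = j.succ ↔ m = q j ∧ n = p j)
    (h : ∀ X m, (⟨ħ, η, z + Complex.I * ħ / 2, cE, cF, σ⟩ : EvalData).IsCoefficient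
      (coproduct ħ 1 0 X) N J (e m) (L m X)) (j : Fin r) :
    (EqMul (strip η σ (point ħ z j (3 / 4))) (shRatio ħ η z j (-2) (3 / 4))
        (J j.succ (.Hp j)) (L j.succ (.Hp j)) ∧
      EqMul (strip η σ (point ħ z j (3 / 4))) (shRatio ħ η z j 2 (3 / 4))
        (J j.castSucc (.Hp j)) (L j.castSucc (.Hp j)) ∧
      ∀ l, l ≠ j.succ → l ≠ j.castSucc → L l (.Hp j) = J l (.Hp j)) ∧
    (EqMul (strip η (-σ) (point ħ z j (1 / 4))) (shRatio ħ η z j (-2) (1 / 4))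
        (J j.succ (.Hm j)) (L j.succ (.Hm j)) ∧
      EqMul (strip η (-σ) (point ħ z j (1 / 4))) (shRatio ħ η z j 2 (1 / 4))
        (J j.castSucc (.Hm j)) (L j.castSucc (.Hm j)) ∧
      ∀ l, l ≠ j.succ → l ≠ j.castSucc → L l (.Hm j) = J l (.Hm j)) ∧
    (EqDelta (deltaCoeff ħ η σ cE) (point ħ z j 0)
        (fun φ => J (q j) (.Hm j) (φ.shift (Complex.I * ħ / 4)))
        (L (p j) (.E j) - J (p j) (.E j)) ∧
      ∀ l, l ≠ p j → L l (.E j) = J l (.E j)) ∧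
    (EqMul (strip η σ (point ħ z j (1 / 2))) (shRatio ħ η z j (-2) (1 / 2))
        (J j.succ (.F j)) (fun φ => L j.succ (.F j) φ - if j.succ = q j then
          deltaCoeff ħ η σ cF * φ (point ħ z j (1 / 2)) * N (p j) else 0) ∧
      EqMul (strip η σ (point ħ z j (1 / 2))) (shRatio ħ η z j 2 (1 / 2))
        (J j.castSucc (.F j)) (fun φ => L j.castSucc (.F j) φ - if j.castSucc = q j then
          deltaCoeff ħ η σ cF * φ (point ħ z j (1 / 2)) * N (p j) else 0) ∧
      ∀ l, l ≠ j.succ → l ≠ j.castSucc → (fun φ => L l (.F j) φ - if l = q j then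
          deltaCoeff ħ η σ cF * φ (point ħ z j (1 / 2)) * N (p j) else 0) = J l (.F j)) := by
  have hHp : coproduct ħ 1 0 (.Hp j) =
      [(.cur (.Hp j) 0, .cur (.Hp j) (-(Complex.I * ħ / 4)))] := by simp [coproduct]
  have hHm : coproduct ħ 1 0 (.Hm j) =
      [(.cur (.Hm j) 0, .cur (.Hm j) (Complex.I * ħ / 4))] := by simp [coproduct]
  have hcE : coproduct ħ 1 0 (.E j) = [(.cur (.E j) 0, .one),
      (.cur (.Hm j) (Complex.I * ħ / 4), .cur (.E j) (Complex.I * ħ / 2))] := by simp [coproduct]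
  have hcF : coproduct ħ 1 0 (.F j) = [(.one, .cur (.F j) 0),
      (.cur (.F j) 0, .cur (.Hp j) 0)] := by simp [coproduct]
  refine ⟨eqMul_of_isProduct_Hp (cE := cE) (cF := cF) (τ := -(Complex.I * ħ / 4))
      (J := fun n => J n (.Hp j)) (L := fun n => L n (.Hp j)) j (by ring) fun m => ?_,
    eqMul_of_isProduct_Hm (cE := cE) (cF := cF) (τ := Complex.I * ħ / 4)
      (J := fun n => J n (.Hm j)) (L := fun n => L n (.Hm j)) j (by ring) fun m => ?_, ?_,
    eqMul_of_isProduct_Hp (cE := cE) (cF := cF) (τ := 0)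
      (J := fun n => J n (.F j)) (L := fun m φ => L m (.F j) φ - if m = q j then
          deltaCoeff ħ η σ cF * φ (point ħ z j (1 / 2)) * N (p j) else 0) j (by ring) fun m => ?_⟩
  · have hc := h (.Hp j) m
    rw [hHp] at hc
    have := EvalData.isProduct_of_isCoefficient_singleton hc
      fun n => (hdiag m n).mp
    rwa [he] at this
  · have hc := h (.Hm j) m
    rw [hHm] at hc
    have := EvalData.isProduct_of_isCoefficient_singleton hc
      fun n => (hdiag m n).mp
    rwa [he] at this
  · obtain ⟨h1, h2⟩ := EvalData.isProduct_commutator (Z := .E j) (m₀ := p j) (n₀ := q j)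
      (fun m => hcE ▸ h (.E j) m) hdiag (hE j)
    have hpq := (hE j (p j) (q j)).mpr ⟨rfl, rfl⟩
    rw [hpq.1, hpq.2] at h1
    exact ⟨eqDelta_of_isProduct_E hη j h1, h2⟩
  · have hc := h (.F j) m
    rw [hcF] at hc
    have := EvalData.isProduct_of_isCoefficient_one_left hc
      fun n => (hdiag m n).mp
    rw [he] at this
    convert this using 3 with φ
    simp only [EvalData.op_F _ (show EvalData.η ⟨ħ, η, z + Complex.I * ħ / 2, cE, cF, σ⟩ ≠ 0
      from hη), hF, pole_eq_point]
    by_cases hm : m = q j <;> simp [hm]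

/-- The relations which follow from the comultiplication when the Fock space is the second factor.
The conventions for `e`, `p` and `q` are those of `relations_of_isCoefficient_one_zero`. -/
theorem relations_of_isCoefficient_zero_one (hη : η ≠ 0)
    (he : ∀ m, e m m = (m, m)) (hdiag : ∀ m n, (e m n).1 = (e m n).2 ↔ n = m)
    (hE : ∀ j m n, (e m n).2 = j.succ ∧ (e m n).1 = j.castSucc ↔ m = p j ∧ n = q j)
    (hF : ∀ j m n, (e m n).2 = j.castSucc ∧ (e m n).1 = j.succ ↔ m = q j ∧ n = p j)
    (h : ∀ X m, (⟨ħ, η, z + Complex.I * ħ / 2, cE, cF, σ⟩ : EvalData).IsCoefficient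
      ((coproduct ħ 0 1 X).map Prod.swap) N J (e m) (L m X)) (j : Fin r) :
    (EqMul (strip η σ (point ħ z j (1 / 4))) (shRatio ħ η z j (-2) (1 / 4))
        (J j.succ (.Hp j)) (L j.succ (.Hp j)) ∧
      EqMul (strip η σ (point ħ z j (1 / 4))) (shRatio ħ η z j 2 (1 / 4))
        (J j.castSucc (.Hp j)) (L j.castSucc (.Hp j)) ∧
      ∀ l, l ≠ j.succ → l ≠ j.castSucc → L l (.Hp j) = J l (.Hp j)) ∧
    (EqMul (strip η (-σ) (point ħ z j (3 / 4))) (shRatio ħ η z j (-2) (3 / 4))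
        (J j.succ (.Hm j)) (L j.succ (.Hm j)) ∧
      EqMul (strip η (-σ) (point ħ z j (3 / 4))) (shRatio ħ η z j 2 (3 / 4))
        (J j.castSucc (.Hm j)) (L j.castSucc (.Hm j)) ∧
      ∀ l, l ≠ j.succ → l ≠ j.castSucc → L l (.Hm j) = J l (.Hm j)) ∧
    (EqMul (strip η (-σ) (point ħ z j (1 / 2))) (shRatio ħ η z j (-2) (1 / 2))
        (J j.succ (.E j)) (fun φ => L j.succ (.E j) φ - if j.succ = p j then
          deltaCoeff ħ η σ cE * φ (point ħ z j (1 / 2)) * N (q j) else 0) ∧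
      EqMul (strip η (-σ) (point ħ z j (1 / 2))) (shRatio ħ η z j 2 (1 / 2))
        (J j.castSucc (.E j)) (fun φ => L j.castSucc (.E j) φ - if j.castSucc = p j then
          deltaCoeff ħ η σ cE * φ (point ħ z j (1 / 2)) * N (q j) else 0) ∧
      ∀ l, l ≠ j.succ → l ≠ j.castSucc → (fun φ => L l (.E j) φ - if l = p j then
          deltaCoeff ħ η σ cE * φ (point ħ z j (1 / 2)) * N (q j) else 0) = J l (.E j)) ∧
    (EqDelta (deltaCoeff ħ η σ cF) (point ħ z j 0)
        (fun φ => J (p j) (.Hp j) (φ.shift (Complex.I * ħ / 4)))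
        (L (q j) (.F j) - J (q j) (.F j)) ∧
      ∀ l, l ≠ q j → L l (.F j) = J l (.F j)) := by
  have hHp : (coproduct ħ 0 1 (.Hp j)).map Prod.swap =
      [(.cur (.Hp j) 0, .cur (.Hp j) (Complex.I * ħ / 4))] := by simp [coproduct]
  have hHm : (coproduct ħ 0 1 (.Hm j)).map Prod.swap =
      [(.cur (.Hm j) 0, .cur (.Hm j) (-(Complex.I * ħ / 4)))] := by simp [coproduct]
  have hcE : (coproduct ħ 0 1 (.E j)).map Prod.swap = [(.one, .cur (.E j) 0),
      (.cur (.E j) 0, .cur (.Hm j) 0)] := by simp [coproduct]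
  have hcF : (coproduct ħ 0 1 (.F j)).map Prod.swap = [(.cur (.F j) 0, .one),
      (.cur (.Hp j) (Complex.I * ħ / 4), .cur (.F j) (Complex.I * ħ / 2))] := by simp [coproduct]
  refine ⟨eqMul_of_isProduct_Hp (cE := cE) (cF := cF) (τ := Complex.I * ħ / 4)
      (J := fun n => J n (.Hp j)) (L := fun n => L n (.Hp j)) j (by ring) fun m => ?_,
    eqMul_of_isProduct_Hm (cE := cE) (cF := cF) (τ := -(Complex.I * ħ / 4))
      (J := fun n => J n (.Hm j)) (L := fun n => L n (.Hm j)) j (by ring) fun m => ?_,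
    eqMul_of_isProduct_Hm (cE := cE) (cF := cF) (τ := 0)
      (J := fun n => J n (.E j)) (L := fun m φ => L m (.E j) φ - if m = p j then
          deltaCoeff ħ η σ cE * φ (point ħ z j (1 / 2)) * N (q j) else 0) j (by ring) fun m => ?_,
    ?_⟩
  · have hc := h (.Hp j) m
    rw [hHp] at hc
    have := EvalData.isProduct_of_isCoefficient_singleton hc
      fun n => (hdiag m n).mp
    rwa [he] at this
  · have hc := h (.Hm j) m
    rw [hHm] at hc
    have := EvalData.isProduct_of_isCoefficient_singleton hc
      fun n => (hdiag m n).mp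
    rwa [he] at this
  · have hc := h (.E j) m
    rw [hcE] at hc
    have := EvalData.isProduct_of_isCoefficient_one_left hc
      fun n => (hdiag m n).mp
    rw [he] at this
    convert this using 3 with φ
    simp only [EvalData.op_E _ (show EvalData.η ⟨ħ, η, z + Complex.I * ħ / 2, cE, cF, σ⟩ ≠ 0
      from hη), hE, pole_eq_point]
    by_cases hm : m = p j <;> simp [hm]
  · obtain ⟨h1, h2⟩ := EvalData.isProduct_commutator (Z := .F j) (m₀ := q j) (n₀ := p j)
      (fun m => hcF ▸ h (.F j) m) hdiag (hF j)
    have hpq := (hF j (q j) (p j)).mpr ⟨rfl, rfl⟩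
    rw [hpq.1, hpq.2] at h1
    exact ⟨eqDelta_of_isProduct_F hη j h1, h2⟩

end Relations

end FockVertex

open FockVertex TensorProduct in
theorem mainTheorem6 (r : ℕ) (ħ η : ℝ) (hħ : ħ ≠ 0) (hη : η ≠ 0) (hη' : ħ + 1 / η ≠ 0)
    (z cE cF : ℂ) (σ : ℤˣ) :
    (∀ Φ : fock r ħ η →ₗ[ℂ] FockHat r ħ η ⊗[ℂ] EvalSpace r,
      IsPhi ⟨ħ, etaPrime ħ η, z + Complex.I * ħ / 2, cE, cF, σ⟩ Φ → ∀ (ξ : leftFock r ħ η) (w : fock r ħ η),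
        (∀ j : Fin r,
          EqMul (strip (etaPrime ħ η) σ (point ħ z j (3 / 4))) (shRatio ħ (etaPrime ħ η) z j (-2) (3 / 4))
            (after (.Hp j) (compPhi Φ j.succ) ξ w) (before (compPhi Φ j.succ) (.Hp j) ξ w) ∧
          EqMul (strip (etaPrime ħ η) σ (point ħ z j (3 / 4))) (shRatio ħ (etaPrime ħ η) z j (2) (3 / 4))
            (after (.Hp j) (compPhi Φ j.castSucc) ξ w) (before (compPhi Φ j.castSucc) (.Hp j) ξ w) ∧
          ∀ l : Fin (r + 1), l ≠ j.succ → l ≠ j.castSucc →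
            before (compPhi Φ l) (.Hp j) ξ w = after (.Hp j) (compPhi Φ l) ξ w) ∧
        (∀ j : Fin r,
          EqMul (strip (etaPrime ħ η) (-σ) (point ħ z j (1 / 4))) (shRatio ħ (etaPrime ħ η) z j (-2) (1 / 4))
            (after (.Hm j) (compPhi Φ j.succ) ξ w) (before (compPhi Φ j.succ) (.Hm j) ξ w) ∧
          EqMul (strip (etaPrime ħ η) (-σ) (point ħ z j (1 / 4))) (shRatio ħ (etaPrime ħ η) z j (2) (1 / 4))
            (after (.Hm j) (compPhi Φ j.castSucc) ξ w) (before (compPhi Φ j.castSucc) (.Hm j) ξ w) ∧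
          ∀ l : Fin (r + 1), l ≠ j.succ → l ≠ j.castSucc →
            before (compPhi Φ l) (.Hm j) ξ w = after (.Hm j) (compPhi Φ l) ξ w) ∧
        (∀ j : Fin r,
          EqDelta (deltaCoeff ħ (etaPrime ħ η) σ cE) (point ħ z j 0)
            (fun φ => after (.Hm j) (compPhi Φ j.succ) ξ w (φ.shift (Complex.I * ħ / 4)))
            (before (compPhi Φ j.castSucc) (.E j) ξ w - after (.E j) (compPhi Φ j.castSucc) ξ w) ∧
          ∀ l : Fin (r + 1), l ≠ j.castSucc →
            before (compPhi Φ l) (.E j) ξ w = after (.E j) (compPhi Φ l) ξ w) ∧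
        (∀ j : Fin r,
          EqMul (strip (etaPrime ħ η) σ (point ħ z j (1 / 2))) (shRatio ħ (etaPrime ħ η) z j (-2) (1 / 2))
            (after (.F j) (compPhi Φ j.succ) ξ w)
            (fun φ => before (compPhi Φ j.succ) (.F j) ξ w φ -
              deltaCoeff ħ (etaPrime ħ η) σ cF * φ (point ħ z j (1 / 2)) * (compPhi Φ j.castSucc) w ξ) ∧
          EqMul (strip (etaPrime ħ η) σ (point ħ z j (1 / 2))) (shRatio ħ (etaPrime ħ η) z j (2) (1 / 2))
            (after (.F j) (compPhi Φ j.castSucc) ξ w)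
            (before (compPhi Φ j.castSucc) (.F j) ξ w) ∧
          ∀ l : Fin (r + 1), l ≠ j.succ → l ≠ j.castSucc →
            before (compPhi Φ l) (.F j) ξ w = after (.F j) (compPhi Φ l) ξ w)) ∧
    (∀ Φ : fock r ħ η ⊗[ℂ] EvalSpace r →ₗ[ℂ] FockHat r ħ η,
      IsPhiStar ⟨ħ, etaPrime ħ η, z + Complex.I * ħ / 2, cE, cF, σ⟩ Φ → ∀ (ξ : leftFock r ħ η) (w : fock r ħ η),
        (∀ j : Fin r,
          EqMul (strip (etaPrime ħ η) σ (point ħ z j (3 / 4))) (shRatio ħ (etaPrime ħ η) z j (-2) (3 / 4))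
            (before (compPhiStar Φ j.succ) (.Hp j) ξ w) (after (.Hp j) (compPhiStar Φ j.succ) ξ w) ∧
          EqMul (strip (etaPrime ħ η) σ (point ħ z j (3 / 4))) (shRatio ħ (etaPrime ħ η) z j (2) (3 / 4))
            (before (compPhiStar Φ j.castSucc) (.Hp j) ξ w) (after (.Hp j) (compPhiStar Φ j.castSucc) ξ w) ∧
          ∀ l : Fin (r + 1), l ≠ j.succ → l ≠ j.castSucc →
            after (.Hp j) (compPhiStar Φ l) ξ w = before (compPhiStar Φ l) (.Hp j) ξ w) ∧
        (∀ j : Fin r,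
          EqMul (strip (etaPrime ħ η) (-σ) (point ħ z j (1 / 4))) (shRatio ħ (etaPrime ħ η) z j (-2) (1 / 4))
            (before (compPhiStar Φ j.succ) (.Hm j) ξ w) (after (.Hm j) (compPhiStar Φ j.succ) ξ w) ∧
          EqMul (strip (etaPrime ħ η) (-σ) (point ħ z j (1 / 4))) (shRatio ħ (etaPrime ħ η) z j (2) (1 / 4))
            (before (compPhiStar Φ j.castSucc) (.Hm j) ξ w) (after (.Hm j) (compPhiStar Φ j.castSucc) ξ w) ∧
          ∀ l : Fin (r + 1), l ≠ j.succ → l ≠ j.castSucc →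
            after (.Hm j) (compPhiStar Φ l) ξ w = before (compPhiStar Φ l) (.Hm j) ξ w) ∧
        (∀ j : Fin r,
          EqDelta (deltaCoeff ħ (etaPrime ħ η) σ cE) (point ħ z j 0)
            (fun φ => before (compPhiStar Φ j.castSucc) (.Hm j) ξ w (φ.shift (Complex.I * ħ / 4)))
            (after (.E j) (compPhiStar Φ j.succ) ξ w - before (compPhiStar Φ j.succ) (.E j) ξ w) ∧
          ∀ l : Fin (r + 1), l ≠ j.succ →
            after (.E j) (compPhiStar Φ l) ξ w = before (compPhiStar Φ l) (.E j) ξ w) ∧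
        (∀ j : Fin r,
          EqMul (strip (etaPrime ħ η) σ (point ħ z j (1 / 2))) (shRatio ħ (etaPrime ħ η) z j (-2) (1 / 2))
            (before (compPhiStar Φ j.succ) (.F j) ξ w)
            (after (.F j) (compPhiStar Φ j.succ) ξ w) ∧
          EqMul (strip (etaPrime ħ η) σ (point ħ z j (1 / 2))) (shRatio ħ (etaPrime ħ η) z j (2) (1 / 2))
            (before (compPhiStar Φ j.castSucc) (.F j) ξ w)
            (fun φ => after (.F j) (compPhiStar Φ j.castSucc) ξ w φ -
              deltaCoeff ħ (etaPrime ħ η) σ cF * φ (point ħ z j (1 / 2)) * (compPhiStar Φ j.succ) w ξ) ∧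
          ∀ l : Fin (r + 1), l ≠ j.succ → l ≠ j.castSucc →
            after (.F j) (compPhiStar Φ l) ξ w = before (compPhiStar Φ l) (.F j) ξ w)) ∧
    (∀ Ψ : EvalSpace r ⊗[ℂ] fock r ħ η →ₗ[ℂ] FockHat r ħ η,
      IsPsiStar ⟨ħ, η, z + Complex.I * ħ / 2, cE, cF, σ⟩ Ψ → ∀ (ξ : leftFock r ħ η) (w : fock r ħ η),
        (∀ j : Fin r,
          EqMul (strip η σ (point ħ z j (1 / 4))) (shRatio ħ η z j (-2) (1 / 4))
            (before (compPsiStar Ψ j.succ) (.Hp j) ξ w) (after (.Hp j) (compPsiStar Ψ j.succ) ξ w) ∧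
          EqMul (strip η σ (point ħ z j (1 / 4))) (shRatio ħ η z j (2) (1 / 4))
            (before (compPsiStar Ψ j.castSucc) (.Hp j) ξ w) (after (.Hp j) (compPsiStar Ψ j.castSucc) ξ w) ∧
          ∀ l : Fin (r + 1), l ≠ j.succ → l ≠ j.castSucc →
            after (.Hp j) (compPsiStar Ψ l) ξ w = before (compPsiStar Ψ l) (.Hp j) ξ w) ∧
        (∀ j : Fin r,
          EqMul (strip η (-σ) (point ħ z j (3 / 4))) (shRatio ħ η z j (-2) (3 / 4))
            (before (compPsiStar Ψ j.succ) (.Hm j) ξ w) (after (.Hm j) (compPsiStar Ψ j.succ) ξ w) ∧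
          EqMul (strip η (-σ) (point ħ z j (3 / 4))) (shRatio ħ η z j (2) (3 / 4))
            (before (compPsiStar Ψ j.castSucc) (.Hm j) ξ w) (after (.Hm j) (compPsiStar Ψ j.castSucc) ξ w) ∧
          ∀ l : Fin (r + 1), l ≠ j.succ → l ≠ j.castSucc →
            after (.Hm j) (compPsiStar Ψ l) ξ w = before (compPsiStar Ψ l) (.Hm j) ξ w) ∧
        (∀ j : Fin r,
          EqMul (strip η (-σ) (point ħ z j (1 / 2))) (shRatio ħ η z j (-2) (1 / 2))
            (before (compPsiStar Ψ j.succ) (.E j) ξ w)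
            (fun φ => after (.E j) (compPsiStar Ψ j.succ) ξ w φ -
              deltaCoeff ħ η σ cE * φ (point ħ z j (1 / 2)) * (compPsiStar Ψ j.castSucc) w ξ) ∧
          EqMul (strip η (-σ) (point ħ z j (1 / 2))) (shRatio ħ η z j (2) (1 / 2))
            (before (compPsiStar Ψ j.castSucc) (.E j) ξ w)
            (after (.E j) (compPsiStar Ψ j.castSucc) ξ w) ∧
          ∀ l : Fin (r + 1), l ≠ j.succ → l ≠ j.castSucc →
            after (.E j) (compPsiStar Ψ l) ξ w = before (compPsiStar Ψ l) (.E j) ξ w) ∧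
        (∀ j : Fin r,
          EqDelta (deltaCoeff ħ η σ cF) (point ħ z j 0)
            (fun φ => before (compPsiStar Ψ j.succ) (.Hp j) ξ w (φ.shift (Complex.I * ħ / 4)))
            (after (.F j) (compPsiStar Ψ j.castSucc) ξ w - before (compPsiStar Ψ j.castSucc) (.F j) ξ w) ∧
          ∀ l : Fin (r + 1), l ≠ j.castSucc →
            after (.F j) (compPsiStar Ψ l) ξ w = before (compPsiStar Ψ l) (.F j) ξ w)) ∧
    (∀ Ψ : fock r ħ η →ₗ[ℂ] EvalSpace r ⊗[ℂ] FockHat r ħ η,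
      IsPsi ⟨ħ, η, z + Complex.I * ħ / 2, cE, cF, σ⟩ Ψ → ∀ (ξ : leftFock r ħ η) (w : fock r ħ η),
        (∀ j : Fin r,
          EqMul (strip η σ (point ħ z j (1 / 4))) (shRatio ħ η z j (-2) (1 / 4))
            (after (.Hp j) (compPsi Ψ j.succ) ξ w) (before (compPsi Ψ j.succ) (.Hp j) ξ w) ∧
          EqMul (strip η σ (point ħ z j (1 / 4))) (shRatio ħ η z j (2) (1 / 4))
            (after (.Hp j) (compPsi Ψ j.castSucc) ξ w) (before (compPsi Ψ j.castSucc) (.Hp j) ξ w) ∧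
          ∀ l : Fin (r + 1), l ≠ j.succ → l ≠ j.castSucc →
            before (compPsi Ψ l) (.Hp j) ξ w = after (.Hp j) (compPsi Ψ l) ξ w) ∧
        (∀ j : Fin r,
          EqMul (strip η (-σ) (point ħ z j (3 / 4))) (shRatio ħ η z j (-2) (3 / 4))
            (after (.Hm j) (compPsi Ψ j.succ) ξ w) (before (compPsi Ψ j.succ) (.Hm j) ξ w) ∧
          EqMul (strip η (-σ) (point ħ z j (3 / 4))) (shRatio ħ η z j (2) (3 / 4))
            (after (.Hm j) (compPsi Ψ j.castSucc) ξ w) (before (compPsi Ψ j.castSucc) (.Hm j) ξ w) ∧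
          ∀ l : Fin (r + 1), l ≠ j.succ → l ≠ j.castSucc →
            before (compPsi Ψ l) (.Hm j) ξ w = after (.Hm j) (compPsi Ψ l) ξ w) ∧
        (∀ j : Fin r,
          EqMul (strip η (-σ) (point ħ z j (1 / 2))) (shRatio ħ η z j (-2) (1 / 2))
            (after (.E j) (compPsi Ψ j.succ) ξ w)
            (before (compPsi Ψ j.succ) (.E j) ξ w) ∧
          EqMul (strip η (-σ) (point ħ z j (1 / 2))) (shRatio ħ η z j (2) (1 / 2))
            (after (.E j) (compPsi Ψ j.castSucc) ξ w)
            (fun φ => before (compPsi Ψ j.castSucc) (.E j) ξ w φ -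
              deltaCoeff ħ η σ cE * φ (point ħ z j (1 / 2)) * (compPsi Ψ j.succ) w ξ) ∧
          ∀ l : Fin (r + 1), l ≠ j.succ → l ≠ j.castSucc →
            before (compPsi Ψ l) (.E j) ξ w = after (.E j) (compPsi Ψ l) ξ w) ∧
        (∀ j : Fin r,
          EqDelta (deltaCoeff ħ η σ cF) (point ħ z j 0)
            (fun φ => after (.Hp j) (compPsi Ψ j.castSucc) ξ w (φ.shift (Complex.I * ħ / 4)))
            (before (compPsi Ψ j.succ) (.F j) ξ w - after (.F j) (compPsi Ψ j.succ) ξ w) ∧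
          ∀ l : Fin (r + 1), l ≠ j.succ →
            before (compPsi Ψ l) (.F j) ξ w = after (.F j) (compPsi Ψ l) ξ w)) := by
  have hη₁ : etaPrime ħ η ≠ 0 := one_div_ne_zero hη'
  have hne : ∀ j : Fin r, j.castSucc ≠ j.succ := fun j => Fin.castSucc_lt_succ.ne
  -- Components of `Φ`, `Ψ` enter through rows, those of `Φ*`, `Ψ*` through columns.
  refine ⟨fun Φ hΦ ξ w => ?_, fun Φ hΦ ξ w => ?_, fun Ψ hΨ ξ w => ?_, fun Ψ hΨ ξ w => ?_⟩
  · have H := relations_of_isCoefficient_one_zero (N := fun n => compPhi Φ n w ξ)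
      (J := fun n Y => after Y (compPhi Φ n) ξ w) (L := fun m X => before (compPhi Φ m) X ξ w)
      (e := fun m n => (m, n)) (p := Fin.castSucc) (q := Fin.succ) hη₁ (fun _ => rfl)
      (fun _ _ => eq_comm) (fun _ _ _ => and_comm) (fun _ _ _ => and_comm)
      (fun X m => hΦ X ξ w m)
    refine ⟨fun j => (H j).1, fun j => (H j).2.1, fun j => (H j).2.2.1, fun j => ?_⟩
    obtain ⟨h1, h2, h3⟩ := (H j).2.2.2
    simp only [if_true, if_neg (hne j), sub_zero] at h1 h2
    refine ⟨h1, h2, fun l hl hl' => ?_⟩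
    have := h3 l hl hl'
    simpa only [if_neg hl, sub_zero] using this
  · have H := relations_of_isCoefficient_one_zero (N := fun n => compPhiStar Φ n w ξ)
      (J := fun n Y => before (compPhiStar Φ n) Y ξ w)
      (L := fun m X => after X (compPhiStar Φ m) ξ w)
      (e := fun m n => (n, m)) (p := Fin.succ) (q := Fin.castSucc) hη₁ (fun _ => rfl)
      (fun _ _ => Iff.rfl) (fun _ _ _ => Iff.rfl) (fun _ _ _ => Iff.rfl)
      (fun X m => hΦ X ξ w m)
    refine ⟨fun j => (H j).1, fun j => (H j).2.1, fun j => (H j).2.2.1, fun j => ?_⟩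
    obtain ⟨h1, h2, h3⟩ := (H j).2.2.2
    simp only [if_true, if_neg (hne j).symm, sub_zero] at h1 h2
    refine ⟨h1, h2, fun l hl hl' => ?_⟩
    have := h3 l hl hl'
    simpa only [if_neg hl', sub_zero] using this
  · have H := relations_of_isCoefficient_zero_one (N := fun n => compPsiStar Ψ n w ξ)
      (J := fun n Y => before (compPsiStar Ψ n) Y ξ w)
      (L := fun m X => after X (compPsiStar Ψ m) ξ w)
      (e := fun m n => (n, m)) (p := Fin.succ) (q := Fin.castSucc) hη (fun _ => rfl)
      (fun _ _ => Iff.rfl) (fun _ _ _ => Iff.rfl) (fun _ _ _ => Iff.rfl)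
      (fun X m => hΨ X ξ w m)
    refine ⟨fun j => (H j).1, fun j => (H j).2.1, fun j => ?_, fun j => (H j).2.2.2⟩
    obtain ⟨h1, h2, h3⟩ := (H j).2.2.1
    simp only [if_true, if_neg (hne j), sub_zero] at h1 h2
    refine ⟨h1, h2, fun l hl hl' => ?_⟩
    have := h3 l hl hl'
    simpa only [if_neg hl, sub_zero] using this
  · have H := relations_of_isCoefficient_zero_one (N := fun n => compPsi Ψ n w ξ)
      (J := fun n Y => after Y (compPsi Ψ n) ξ w) (L := fun m X => before (compPsi Ψ m) X ξ w)
      (e := fun m n => (m, n)) (p := Fin.castSucc) (q := Fin.succ) hη (fun _ => rfl)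
      (fun _ _ => eq_comm) (fun _ _ _ => and_comm) (fun _ _ _ => and_comm)
      (fun X m => hΨ X ξ w m)
    refine ⟨fun j => (H j).1, fun j => (H j).2.1, fun j => ?_, fun j => (H j).2.2.2⟩
    obtain ⟨h1, h2, h3⟩ := (H j).2.2.1
    simp only [if_true, if_neg (hne j).symm, sub_zero] at h1 h2
    refine ⟨h1, h2, fun l hl hl' => ?_⟩
    have := h3 l hl hl'
    simpa only [if_neg hl', sub_zero] using this
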